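/- **Setting.** Let $\mathcal H=\ell^2(\mathbb N)$ with canonical (Fock) basis $(|n\rangle)_{n\ge 0}$, number operator $N|n\rangle=n|n\rangle$ and annihilation and creation operators $a,a^*$. Let $\varepsilon,\varepsilon_0,\tau,\beta>0$, $\lambda\in\mathbb R\setminus\{0\}$, and put $$\eta=\Big(\frac{(\varepsilon-\varepsilon_0)\tau}{2\pi}\Big)^2,\quad \xi=\Big(\frac{\lambda\tau}{\pi}\Big)^2,\quad p_-=\frac1{1+e^{-\beta\varepsilon}},\quad p_+=\frac{e^{-\beta\varepsilon}}{1+e^{-\beta\varepsilon}},$$ $$C(N)=\cos(\pi\sqrt{\xi N+\eta})+i\eta^{1/2}\frac{\sin(\pi\sqrt{\xi N+\eta})}{\sqrt{\xi N+\eta}},\qquad S(N)=\xi^{1/2}\frac{\sin(\pi\sqrt{\xi N+\eta})}{\sqrt{\xi N+\eta}},$$ $$V_{--}=p_-^{1/2}e^{-i\tau\varepsilon N}C(N),\quad V_{-+}=p_-^{1/2}e^{-i\tau\varepsilon N}S(N+1)a,\quad V_{+-}=p_+^{1/2}e^{-i\tau\varepsilon N}S(N)a^*,\quad V_{++}=p_+^{1/2}e^{-i\tau\varepsilon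 N}C(N+1)^*.$$ For $\omega=(\omega_1,\omega_2,\dots)\in\Omega=(\{-,+\}^2)^{\mathbb N^*}$ let $W_t(\omega)=V_{\omega_t}\cdots V_{\omega_1}$. For a density operator $\rho$ on $\mathcal H$ let $\mathbb P^\rho$ be the probability measure on $\Omega$ (with the $\sigma$-algebra generated by the cylinders) under which the first $t$ outcomes are $\omega_1,\dots,\omega_t$ with probability $\mathrm{Tr}(W_t(\omega)\rho W_t(\omega)^*)$, and let $\rho_t=W_t\rho W_t^*/\mathrm{Tr}(W_t\rho W_t^*)$ be the quantum trajectory starting from $\rho$. Let $\rho_{\rm inv}=e^{-\beta\varepsilon N}/\mathrm{Tr}(e^{-\beta\varepsilon N})$, let $$M_t=\frac{\rho_{\rm inv}^{1/2}W_t^*W_t\rho_{\rm inv}^{1/2}}{\mathrm{Tr}(W_t^*W_t\rho_{\rm inv})},$$ and let $M_\infty$ be the limit of $(M_t)_t$ in trace norm (where it does not exist, put $M_\infty=0$). Let $R$ be the set of Rabi resonances, i.e. of the integers $n\ge1$ with $\xi n+\eta=k^2$ for some integer $k\ge1$, and let $N(\xi,\eta)=\{n\in\{0\}\cup R:\ n+1\in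 R\}$, so that $\{n\}$, $n\in N(\xi,\eta)$, are the one-dimensional Rabi sectors. The system is *degenerate* if there are $m\in\{0\}\cup R$ and $n\in R$ with $m<n$ and $m+1,n+1\in R$. Let $$Q=\sum_{n\in N(\xi,\eta)}|n\rangle\langle n|,\qquad O=\Big\{\omega\in\Omega:\ M_\infty(\omega)=\frac{Q\rho_{\rm inv}Q}{\mathrm{Tr}(\rho_{\rm inv}Q)}\Big\}.$$ **Proposition.** Suppose the system is degenerate, and let $\rho$ be any density operator on $\mathcal H$. Then $O$ is measurable and $\mathbb P^\rho(O)=\mathrm{Tr}(\rho Q)$. Moreover, for $\mathbb P^\rho$-almost every $\omega\in O$, $$\lim_{t\to\infty}\Big\|\rho_t(\omega)-e^{-i(\varepsilon\tau+\pi\xi)Nt}\,\frac{Q\rho Q}{\mathrm{Tr}(\rho Q)}\,e^{i(\varepsilon\tau+\pi\xi)Nt}\Big\|_1=0,$$ where, in the case that $0\in N(\xi,\eta)$ and $\langle 0,\rho\, m\rangle\ne0$ for some $m\in N(\xi,\eta)\setminus\{0\}$, it is assumed for this last assertion that $\sqrt\eta$ is an integer. -/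

import Mathlib

open Filter Topology MeasureTheory ProbabilityTheory
open scoped ENNReal

noncomputable section

namespace Maser

/-! ### Operators on the Fock space -/

section Generic

variable {H : Type*} [NormedAddCommGroup H] [InnerProductSpace ℂ H] [CompleteSpace H]

/-- The absolute value `|T| = (T* T)^{1/2}` of a bounded operator. -/
def absOp (T : H →L[ℂ] H) : H →L[ℂ] H := CFC.abs T

/-- The positive square root of a positive bounded operator. -/
def sqrtOp (T : H →L[ℂ] H) : H →L[ℂ] H := CFC.sqrt T

end Generic

/-- The bosonic Fock space over `ℂ`, i.e. `ℓ²(ℕ)`. -/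
abbrev FockSpace : Type := lp (fun _ : ℕ => ℂ) 2

/-- Bounded operators on the Fock space. -/
abbrev Op : Type := FockSpace →L[ℂ] FockSpace

/-- The Fock vector `|n⟩`. -/
def fock (n : ℕ) : FockSpace := lp.single 2 n (1 : ℂ)

/-- The matrix element `⟨n, T m⟩`. -/
def entry (T : Op) (n m : ℕ) : ℂ := inner ℂ (fock n) (T (fock m))

/-- The trace `∑ₙ ⟨n, T n⟩`; it is only used for trace class operators. -/
def trace (T : Op) : ℂ := ∑' n, entry T n n

/-- The trace norm `‖T‖₁ = Tr |T| ∈ [0, ∞]`. -/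
def traceNorm (T : Op) : ℝ≥0∞ := ∑' n, ENNReal.ofReal (entry (absOp T) n n).re

/-- Convergence of a sequence of operators in trace norm. -/
def TendstoTraceNorm (T : ℕ → Op) (L : Op) : Prop :=
  Tendsto (fun t => traceNorm (T t - L)) atTop (𝓝 0)

/-- A density operator. For a positive operator, convergence of `∑ₙ ⟨n, ρ n⟩` is the trace class
property, and the value of the sum is the trace (and the trace norm). -/
structure DensityOperator where
  /-- the underlying operator -/
  op : Op
  isPositive : op.IsPositive
  hasSum_entry : HasSum (fun n => entry op n n) 1

lemma entry_eq (T : Op) (n m : ℕ) : entry T n m = T (fock m) n := by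
  simp [entry, fock, lp.inner_single_left]

lemma inner_fock_left (n : ℕ) (x : FockSpace) : inner ℂ (fock n) x = x n := by
  simp [fock, lp.inner_single_left]

lemma fock_apply (n m : ℕ) : fock n m = if m = n then 1 else 0 := by
  by_cases h : m = n
  · subst h; simp [fock]
  · simp [fock, h]

lemma summable_sq (x : FockSpace) : Summable fun n => ‖x n‖ ^ 2 := by
  have := (lp.memℓp x).summable (by norm_num : 0 < (2 : ℝ≥0∞).toReal)
  simpa using this

lemma norm_sq_eq (x : FockSpace) : ‖x‖ ^ 2 = ∑' n, ‖x n‖ ^ 2 := by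
  have := lp.norm_rpow_eq_tsum (by norm_num : 0 < (2 : ℝ≥0∞).toReal) x
  simpa using this

lemma mem_of_summable {x : ℕ → ℂ} (h : Summable fun n => ‖x n‖ ^ 2) :
    Memℓp (E := fun _ : ℕ => ℂ) x 2 :=
  memℓp_gen (by simpa using h)

lemma norm_le_of_sq {x : FockSpace} {c : ℝ} (hc : 0 ≤ c)
    (h : ∑' n, ‖x n‖ ^ 2 ≤ c ^ 2) : ‖x‖ ≤ c := by
  rw [← norm_sq_eq] at h
  exact le_of_sq_le_sq h hc

lemma summable_mul {f : ℕ → ℂ} {C : ℝ} (hC : ∀ n, ‖f n‖ ≤ C) (x : FockSpace) :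
    Summable fun n => ‖f n * x n‖ ^ 2 := by
  refine Summable.of_nonneg_of_le (fun n => by positivity) (fun n => ?_)
    ((summable_sq x).mul_left (C ^ 2))
  rw [norm_mul, mul_pow]
  gcongr
  exact hC n

/-- The bounded operator `f(N)`, `f(N)|n⟩ = f(n)|n⟩`, for a bounded function `f` of the number
operator `N` (and `0` if `f` is unbounded). -/
def funN (f : ℕ → ℂ) : Op :=
  open Classical in
  if h : ∃ C : ℝ, ∀ n, ‖f n‖ ≤ C then
    LinearMap.mkContinuous
      { toFun := fun x => ⟨fun n => f n * x n, mem_of_summable (summable_mul h.choose_spec x)⟩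
        map_add' := fun x y => by ext n; exact mul_add (f n) (x n) (y n)
        map_smul' := fun c x => by ext n; exact mul_left_comm (f n) c (x n) }
      h.choose (fun x => by
        have h0 : 0 ≤ h.choose := (norm_nonneg _).trans (h.choose_spec 0)
        refine norm_le_of_sq (by positivity) ?_
        rw [mul_pow, norm_sq_eq, ← tsum_mul_left]
        refine Summable.tsum_le_tsum (fun n => ?_) (summable_mul h.choose_spec x)
          ((summable_sq x).mul_left _)
        change ‖f n * x n‖ ^ 2 ≤ _
        rw [norm_mul, mul_pow]
        gcongr
        exact h.choose_spec n)
  else 0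

lemma funN_apply {f : ℕ → ℂ} {C : ℝ} (hC : ∀ n, ‖f n‖ ≤ C) (x : FockSpace) (n : ℕ) :
    funN f x n = f n * x n := by
  have h : ∃ C : ℝ, ∀ n, ‖f n‖ ≤ C := ⟨C, hC⟩
  simp [funN, h]

/-- The sequence `(0, x 0, x 1, …)`. -/
def shiftSeq (x : ℕ → ℂ) : ℕ → ℂ
  | 0 => 0
  | n + 1 => x n

lemma summable_shiftSeq (x : FockSpace) : Summable fun n => ‖shiftSeq x n‖ ^ 2 :=
  (summable_nat_add_iff 1).1 (summable_sq x)

/-- The unilateral shift `|n⟩ ↦ |n+1⟩`. With it the creation and annihilation operators are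
`a* = raise √(N+1)` and `a = √(N+1) raise*`. -/
def raise : Op :=
  LinearMap.mkContinuous
    { toFun := fun x => ⟨shiftSeq x, mem_of_summable (summable_shiftSeq x)⟩
      map_add' := fun x y => by
        ext n
        cases n with
        | zero => exact (add_zero (0 : ℂ)).symm
        | succ n => rfl
      map_smul' := fun c x => by
        ext n
        cases n with
        | zero => exact (mul_zero c).symm
        | succ n => rfl }
    1 (fun x => by
      refine norm_le_of_sq (by positivity) ?_
      change ∑' n, ‖shiftSeq x n‖ ^ 2 ≤ _
      rw [one_mul, norm_sq_eq, (summable_shiftSeq x).tsum_eq_zero_add]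
      simp [shiftSeq])

/-- The backward shift `|n+1⟩ ↦ |n⟩`, `|0⟩ ↦ 0`. -/
def lower : Op := ContinuousLinearMap.adjoint raise

lemma mul_op_apply (T T' : Op) (x : FockSpace) : (T * T') x = T (T' x) := rfl

lemma smul_op_apply (c : ℂ) (T : Op) (x : FockSpace) (n : ℕ) : (c • T) x n = c * T x n := rfl

lemma raise_apply_zero (x : FockSpace) : raise x 0 = 0 := rfl

lemma raise_apply_succ (x : FockSpace) (n : ℕ) : raise x (n + 1) = x n := rfl

lemma raise_fock (n : ℕ) : raise (fock n) = fock (n + 1) := by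
  ext k
  cases k with
  | zero => simp [raise_apply_zero, fock_apply]
  | succ k => simp [raise_apply_succ, fock_apply]

lemma lower_apply (x : FockSpace) (n : ℕ) : lower x n = x (n + 1) := by
  rw [← inner_fock_left, lower, ContinuousLinearMap.adjoint_inner_right, raise_fock,
    inner_fock_left]

/-! ### The one-atom maser -/

/-- The parameters of the one-atom maser. -/
structure Params where
  /-- frequency of the cavity mode -/
  ε₀ : ℝ
  /-- Bohr frequency of the atoms -/
  ε : ℝ
  /-- half of the Rabi frequency (coupling constant) -/
  coupling : ℝ
  /-- duration of one interaction -/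
  τ : ℝ
  /-- inverse temperature of the atoms -/
  β : ℝ
  ε₀_pos : 0 < ε₀
  ε_pos : 0 < ε
  coupling_ne_zero : coupling ≠ 0
  τ_pos : 0 < τ

namespace Params

variable (p : Params)

/-- The dimensionless detuning parameter `η = (Δτ/2π)²`, `Δ = ε - ε₀`. -/
def η : ℝ := ((p.ε - p.ε₀) * p.τ / (2 * Real.pi)) ^ 2

/-- The dimensionless coupling constant `ξ = (λτ/π)²`. -/
def ξ : ℝ := (p.coupling * p.τ / Real.pi) ^ 2

/-- Probability that an atom enters in its ground state. -/
def pMinus : ℝ := 1 / (1 + Real.exp (-p.β * p.ε))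

/-- Probability that an atom enters in its excited state. -/
def pPlus : ℝ := Real.exp (-p.β * p.ε) / (1 + Real.exp (-p.β * p.ε))

/-- `√(ξ n + η)`. -/
def rabi (n : ℕ) : ℝ := √(p.ξ * n + p.η)

/-- `C(n) = cos(π√(ξn+η)) + i η^{1/2} sin(π√(ξn+η)) / √(ξn+η)`. If `ξn+η = 0`, i.e. `n = 0 = η`,
the second term is `0`, as it should. -/
def C (n : ℕ) : ℂ :=
  (Real.cos (Real.pi * p.rabi n) : ℂ)
    + Complex.I * (√p.η * (Real.sin (Real.pi * p.rabi n) / p.rabi n) : ℝ)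

/-- `S(n) = ξ^{1/2} sin(π√(ξn+η)) / √(ξn+η)`; only the values at `n ≥ 1` matter. -/
def S (n : ℕ) : ℝ := √p.ξ * (Real.sin (Real.pi * p.rabi n) / p.rabi n)

/-- `e^{-iτεN}`. -/
def phase : Op := funN fun n => Complex.exp (-Complex.I * (p.τ * p.ε * n : ℝ))

end Params

/-- An outcome `(σ, σ')`: the state of the atom measured before and after the interaction, `false`
being the ground state `-` and `true` the excited state `+`. -/
abbrev Outcome : Type := Bool × Bool

/-- Sequences of outcomes; `ω t` is the outcome of the `(t+1)`-st measurement. -/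
abbrev Outcomes : Type := ℕ → Outcome

namespace Params

variable (p : Params)

/-- The Kraus operators
`V₋₋ = p₋^{1/2} e^{-iτεN} C(N)`, `V₋₊ = p₋^{1/2} e^{-iτεN} S(N+1) a`,
`V₊₋ = p₊^{1/2} e^{-iτεN} S(N) a*`, `V₊₊ = p₊^{1/2} e^{-iτεN} C(N+1)*`,
where `S(N+1) a = S(N+1) √(N+1) lower` and `S(N) a* = S(N) √N raise`. -/
def kraus : Outcome → Op
  | (false, false) => (√p.pMinus : ℂ) • (p.phase * funN p.C)
  | (false, true) => (√p.pMinus : ℂ) •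
      (p.phase * (funN (fun n => (p.S (n + 1) * √((n : ℝ) + 1) : ℝ)) * lower))
  | (true, false) => (√p.pPlus : ℂ) •
      (p.phase * (funN (fun n => (p.S n * √(n : ℝ) : ℝ)) * raise))
  | (true, true) => (√p.pPlus : ℂ) •
      (p.phase * funN (fun n => (starRingEnd ℂ) (p.C (n + 1))))

/-- `W_t(ω) = V_{ω_t} ⋯ V_{ω_1}`. -/
def W (ω : Outcomes) : ℕ → Op
  | 0 => 1
  | t + 1 => p.kraus (ω t) * W ω t

/-- `W_t(ω) ρ W_t(ω)*`. -/
def evolved (ρ : Op) (ω : Outcomes) (t : ℕ) : Op :=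
  p.W ω t * ρ * ContinuousLinearMap.adjoint (p.W ω t)

/-- The quantum trajectory `ρ_t(ω) = W_t(ω) ρ W_t(ω)* / Tr(W_t(ω) ρ W_t(ω)*)`. -/
def trajectory (ρ : DensityOperator) (ω : Outcomes) (t : ℕ) : Op :=
  (trace (p.evolved ρ.op ω t))⁻¹ • p.evolved ρ.op ω t

/-- The probability `Tr(W_t(ω) ρ W_t(ω)*)` of the first `t` outcomes being `ω_1, …, ω_t`. -/
def weight (ρ : DensityOperator) (t : ℕ) (ω : Outcomes) : ℝ≥0∞ :=
  ENNReal.ofReal (trace (p.evolved ρ.op ω t)).re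

end Params

/-! ### Helper facts: the Kraus operators preserve the total trace -/

namespace Params

variable (p : Params)

lemma ξ_pos : 0 < p.ξ := by
  have := p.coupling_ne_zero
  have := p.τ_pos.ne'
  have := Real.pi_ne_zero
  unfold ξ
  positivity

lemma η_nonneg : 0 ≤ p.η := by unfold η; positivity

lemma pMinus_nonneg : 0 ≤ p.pMinus := by unfold pMinus; positivity

lemma pPlus_nonneg : 0 ≤ p.pPlus := by unfold pPlus; positivity

lemma pMinus_add_pPlus : p.pMinus + p.pPlus = 1 := by
  unfold pMinus pPlus
  have : (0 : ℝ) < 1 + Real.exp (-p.β * p.ε) := by positivity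
  field_simp

lemma rabi_sq (n : ℕ) : p.rabi n ^ 2 = p.ξ * n + p.η :=
  Real.sq_sqrt (add_nonneg (mul_nonneg p.ξ_pos.le (Nat.cast_nonneg n)) p.η_nonneg)

lemma norm_C_sq_add (n : ℕ) : ‖p.C n‖ ^ 2 + (p.S n * √(n : ℝ)) ^ 2 = 1 := by
  have hC : ‖p.C n‖ ^ 2 = Real.cos (Real.pi * p.rabi n) ^ 2
      + (√p.η * (Real.sin (Real.pi * p.rabi n) / p.rabi n)) ^ 2 := by
    rw [← Complex.normSq_eq_norm_sq, C, mul_comm Complex.I, Complex.normSq_add_mul_I]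
  rw [hC, S]
  simp only [mul_pow, div_pow]
  rw [Real.sq_sqrt p.η_nonneg, Real.sq_sqrt p.ξ_pos.le, Real.sq_sqrt (Nat.cast_nonneg n)]
  by_cases h : p.rabi n = 0
  · simp [h]
  · have h2 : p.rabi n ^ 2 ≠ 0 := pow_ne_zero 2 h
    have h3 := p.rabi_sq n
    have h4 := Real.sin_sq_add_cos_sq (Real.pi * p.rabi n)
    field_simp
    rw [h3]
    linear_combination (p.ξ * n + p.η) * h4

lemma norm_C_le (n : ℕ) : ‖p.C n‖ ≤ 1 := by
  have := p.norm_C_sq_add n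
  have := sq_nonneg (p.S n * √(n : ℝ))
  exact le_of_sq_le_sq (by linarith) zero_le_one

lemma norm_S_le (n : ℕ) : ‖((p.S n * √(n : ℝ) : ℝ) : ℂ)‖ ≤ 1 := by
  have := p.norm_C_sq_add n
  have := sq_nonneg ‖p.C n‖
  rw [Complex.norm_real, Real.norm_eq_abs]
  exact (sq_le_one_iff_abs_le_one _).1 (by linarith)

lemma phase_apply (x : FockSpace) (n : ℕ) :
    p.phase x n = Complex.exp (-Complex.I * (p.τ * p.ε * n : ℝ)) * x n := by
  refine funN_apply (C := 1) (fun n => ?_) x n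
  rw [Complex.norm_exp]
  simp

lemma kraus_mm_apply (x : FockSpace) (n : ℕ) : p.kraus (false, false) x n =
    √p.pMinus * (Complex.exp (-Complex.I * (p.τ * p.ε * n : ℝ)) * p.C n) * x n := by
  simp only [kraus, smul_op_apply, mul_op_apply, phase_apply, funN_apply p.norm_C_le]
  ring

lemma kraus_pp_apply (x : FockSpace) (n : ℕ) : p.kraus (true, true) x n =
    √p.pPlus * (Complex.exp (-Complex.I * (p.τ * p.ε * n : ℝ))
      * (starRingEnd ℂ) (p.C (n + 1))) * x n := by
  have h : ∀ n : ℕ, ‖(starRingEnd ℂ) (p.C (n + 1))‖ ≤ 1 := fun n => by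
    rw [RCLike.norm_conj]
    exact p.norm_C_le _
  simp only [kraus, smul_op_apply, mul_op_apply, phase_apply, funN_apply h]
  ring

lemma kraus_mp_apply (x : FockSpace) (n : ℕ) : p.kraus (false, true) x n =
    √p.pMinus * (Complex.exp (-Complex.I * (p.τ * p.ε * n : ℝ))
      * (p.S (n + 1) * √((n : ℝ) + 1) : ℝ)) * x (n + 1) := by
  have h : ∀ n : ℕ, ‖((p.S (n + 1) * √((n : ℝ) + 1) : ℝ) : ℂ)‖ ≤ 1 := fun n => by
    have := p.norm_S_le (n + 1)
    push_cast at this ⊢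
    exact this
  simp only [kraus, smul_op_apply, mul_op_apply, phase_apply, funN_apply h, lower_apply]
  ring

lemma kraus_pm_apply_zero (x : FockSpace) : p.kraus (true, false) x 0 = 0 := by
  simp only [kraus, smul_op_apply, mul_op_apply, phase_apply, funN_apply p.norm_S_le,
    raise_apply_zero, mul_zero]

lemma kraus_pm_apply_succ (x : FockSpace) (n : ℕ) : p.kraus (true, false) x (n + 1) =
    √p.pPlus * (Complex.exp (-Complex.I * (p.τ * p.ε * (n + 1 : ℕ) : ℝ))
      * (p.S (n + 1) * √((n + 1 : ℕ) : ℝ) : ℝ)) * x n := by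
  simp only [kraus, smul_op_apply, mul_op_apply, phase_apply, funN_apply p.norm_S_le, raise_apply_succ]
  ring

end Params

lemma adjoint_fock_eq {T : Op} {n m : ℕ} {c : ℂ} (h : ∀ x : FockSpace, T x n = c * x m) :
    ContinuousLinearMap.adjoint T (fock n) = (starRingEnd ℂ) c • fock m := by
  refine ext_inner_right ℂ fun x => ?_
  rw [ContinuousLinearMap.adjoint_inner_left, inner_fock_left, h, inner_smul_left,
    inner_fock_left]
  simp

lemma adjoint_fock_eq_zero {T : Op} {n : ℕ} (h : ∀ x : FockSpace, T x n = 0) :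
    ContinuousLinearMap.adjoint T (fock n) = 0 := by
  refine ext_inner_right ℂ fun x => ?_
  rw [ContinuousLinearMap.adjoint_inner_left, inner_fock_left, h, inner_zero_left]

lemma entry_conj_eq (T A : Op) (n : ℕ) : entry (T * A * ContinuousLinearMap.adjoint T) n n =
    inner ℂ (ContinuousLinearMap.adjoint T (fock n))
      (A (ContinuousLinearMap.adjoint T (fock n))) := by
  rw [ContinuousLinearMap.adjoint_inner_left]
  rfl

lemma entry_conj {T : Op} {n m : ℕ} {c : ℂ} (h : ∀ x : FockSpace, T x n = c * x m) (A : Op) :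
    entry (T * A * ContinuousLinearMap.adjoint T) n n = (‖c‖ ^ 2 : ℝ) * entry A m m := by
  rw [entry_conj_eq, adjoint_fock_eq h, map_smul, inner_smul_left, inner_smul_right, entry,
    ← mul_assoc]
  congr 1
  simp [Complex.mul_conj, Complex.normSq_eq_norm_sq]

lemma entry_conj_zero {T : Op} {n : ℕ} (h : ∀ x : FockSpace, T x n = 0) (A : Op) :
    entry (T * A * ContinuousLinearMap.adjoint T) n n = 0 := by
  rw [entry_conj_eq, adjoint_fock_eq_zero h]
  simp

namespace Params

variable (p : Params)

lemma norm_exp_phase (r : ℝ) : ‖Complex.exp (-Complex.I * (r : ℝ))‖ = 1 := by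
  rw [Complex.norm_exp]
  simp

/-- `V A V*` for a Kraus operator `V`. -/
def step (y : Outcome) (A : Op) : Op :=
  p.kraus y * A * ContinuousLinearMap.adjoint (p.kraus y)

lemma entry_mm (A : Op) (n : ℕ) : entry (p.step (false, false) A) n n =
    (p.pMinus * ‖p.C n‖ ^ 2 : ℝ) * entry A n n := by
  rw [step, entry_conj (fun x => p.kraus_mm_apply x n)]
  simp only [norm_mul, norm_exp_phase, mul_pow, Complex.norm_real, Real.norm_eq_abs, sq_abs,
    Real.sq_sqrt p.pMinus_nonneg, one_mul]

lemma entry_pp (A : Op) (n : ℕ) : entry (p.step (true, true) A) n n =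
    (p.pPlus * ‖p.C (n + 1)‖ ^ 2 : ℝ) * entry A n n := by
  rw [step, entry_conj (fun x => p.kraus_pp_apply x n)]
  simp only [norm_mul, norm_exp_phase, mul_pow, Complex.norm_real, Real.norm_eq_abs, sq_abs,
    Real.sq_sqrt p.pPlus_nonneg, one_mul, RCLike.norm_conj]

lemma entry_mp (A : Op) (n : ℕ) : entry (p.step (false, true) A) n n =
    (p.pMinus * (p.S (n + 1) * √((n + 1 : ℕ) : ℝ)) ^ 2 : ℝ) * entry A (n + 1) (n + 1) := by
  rw [step, entry_conj (fun x => p.kraus_mp_apply x n)]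
  simp only [norm_mul, norm_exp_phase, mul_pow, Complex.norm_real, Real.norm_eq_abs, sq_abs,
    Real.sq_sqrt p.pMinus_nonneg, one_mul]
  push_cast
  rfl

lemma entry_pm_zero (A : Op) : entry (p.step (true, false) A) 0 0 = 0 := by
  rw [step, entry_conj_zero (fun x => p.kraus_pm_apply_zero x)]

lemma entry_pm_succ (A : Op) (n : ℕ) : entry (p.step (true, false) A) (n + 1) (n + 1) =
    (p.pPlus * (p.S (n + 1) * √((n + 1 : ℕ) : ℝ)) ^ 2 : ℝ) * entry A n n := by
  rw [step, entry_conj (fun x => p.kraus_pm_apply_succ x n)]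
  simp only [norm_mul, norm_exp_phase, mul_pow, Complex.norm_real, Real.norm_eq_abs, sq_abs,
    Real.sq_sqrt p.pPlus_nonneg, one_mul]

lemma summable_coeff_mul {c : ℕ → ℝ} {K : ℝ} (hc : ∀ n, |c n| ≤ K) {f : ℕ → ℂ}
    (hf : Summable f) : Summable fun n => (c n : ℂ) * f n := by
  refine Summable.of_norm_bounded (hf.norm.mul_left K) fun n => ?_
  rw [norm_mul, Complex.norm_real, Real.norm_eq_abs]
  gcongr
  exact hc n

lemma abs_S_sq_le (n : ℕ) : |(p.S n * √(n : ℝ)) ^ 2| ≤ 1 := by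
  have := p.norm_C_sq_add n
  have := sq_nonneg ‖p.C n‖
  rw [abs_of_nonneg (sq_nonneg _)]
  linarith

lemma abs_C_sq_le (n : ℕ) : |‖p.C n‖ ^ 2| ≤ 1 := by
  have := p.norm_C_sq_add n
  have := sq_nonneg (p.S n * √(n : ℝ))
  rw [abs_of_nonneg (sq_nonneg _)]
  linarith

variable {p} in
lemma sum_step {A : Op} (hA : Summable fun n => entry A n n) :
    (∀ y, Summable fun n => entry (p.step y A) n n) ∧
      ∑ y, trace (p.step y A) = trace A := by
  set a : ℕ → ℂ := fun n => entry A n n with ha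
  have hCa : Summable fun n => ((‖p.C n‖ ^ 2 : ℝ) : ℂ) * a n :=
    summable_coeff_mul p.abs_C_sq_le hA
  have hSa : Summable fun n => (((p.S n * √(n : ℝ)) ^ 2 : ℝ) : ℂ) * a n :=
    summable_coeff_mul p.abs_S_sq_le hA
  have hCa' : Summable fun n => ((‖p.C (n + 1)‖ ^ 2 : ℝ) : ℂ) * a n :=
    summable_coeff_mul (c := fun n => ‖p.C (n + 1)‖ ^ 2) (fun n => p.abs_C_sq_le (n + 1)) hA
  have hSa' : Summable fun n : ℕ =>
      (((p.S (n + 1) * √((n + 1 : ℕ) : ℝ)) ^ 2 : ℝ) : ℂ) * a n :=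
    summable_coeff_mul (c := fun n : ℕ => (p.S (n + 1) * √((n + 1 : ℕ) : ℝ)) ^ 2)
      (fun n => p.abs_S_sq_le (n + 1)) hA
  have hS0 : ∑' n, (((p.S (n + 1) * √((n + 1 : ℕ) : ℝ)) ^ 2 : ℝ) : ℂ) * a (n + 1)
      = ∑' n, (((p.S n * √(n : ℝ)) ^ 2 : ℝ) : ℂ) * a n := by
    rw [hSa.tsum_eq_zero_add]
    simp
  have hmm : (fun n => entry (p.step (false, false) A) n n)
      = fun n => (p.pMinus : ℂ) * (((‖p.C n‖ ^ 2 : ℝ) : ℂ) * a n) := by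
    ext n; rw [entry_mm, ha]; push_cast; ring
  have hpp : (fun n => entry (p.step (true, true) A) n n)
      = fun n => (p.pPlus : ℂ) * (((‖p.C (n + 1)‖ ^ 2 : ℝ) : ℂ) * a n) := by
    ext n; rw [entry_pp, ha]; push_cast; ring
  have hmp : (fun n => entry (p.step (false, true) A) n n)
      = fun n => (p.pMinus : ℂ) *
        ((((p.S (n + 1) * √((n + 1 : ℕ) : ℝ)) ^ 2 : ℝ) : ℂ) * a (n + 1)) := by
    ext n; rw [entry_mp, ha]; push_cast; ring
  have hpm : (fun n => entry (p.step (true, false) A) (n + 1) (n + 1))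
      = fun n => (p.pPlus : ℂ) * ((((p.S (n + 1) * √((n + 1 : ℕ) : ℝ)) ^ 2 : ℝ) : ℂ) * a n) := by
    ext n; rw [entry_pm_succ, ha]; push_cast; ring
  have smm : Summable fun n => entry (p.step (false, false) A) n n := by
    rw [hmm]; exact hCa.mul_left _
  have spp : Summable fun n => entry (p.step (true, true) A) n n := by
    rw [hpp]; exact hCa'.mul_left _
  have smp : Summable fun n => entry (p.step (false, true) A) n n := by
    rw [hmp]; exact ((summable_nat_add_iff 1).2 hSa).mul_left _
  have spm : Summable fun n => entry (p.step (true, false) A) n n := by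
    rw [← summable_nat_add_iff 1, hpm]; exact hSa'.mul_left _
  refine ⟨?_, ?_⟩
  · rintro ⟨σ, σ'⟩
    cases σ <;> cases σ'
    exacts [smm, smp, spm, spp]
  · rw [Fintype.sum_prod_type]
    simp only [Fintype.sum_bool]
    unfold trace
    rw [spm.tsum_eq_zero_add, entry_pm_zero, hmm, hpp, hmp, hpm]
    simp only [tsum_mul_left]
    rw [hS0, zero_add]
    have h1 : ∀ n, ((‖p.C n‖ ^ 2 : ℝ) : ℂ) * a n + (((p.S n * √(n : ℝ)) ^ 2 : ℝ) : ℂ) * a n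
        = a n := fun n => by
      rw [← add_mul, ← Complex.ofReal_add, p.norm_C_sq_add n]; simp
    have h2 : ∀ n : ℕ, (((p.S (n + 1) * √((n + 1 : ℕ) : ℝ)) ^ 2 : ℝ) : ℂ) * a n
        + ((‖p.C (n + 1)‖ ^ 2 : ℝ) : ℂ) * a n = a n := fun n => by
      rw [← add_mul, ← Complex.ofReal_add, add_comm, p.norm_C_sq_add (n + 1)]; simp
    have e1 := hCa.tsum_add hSa
    have e2 := hSa'.tsum_add hCa'
    simp only [h1] at e1
    simp only [h2] at e2
    have e3 : (p.pMinus : ℂ) + p.pPlus = 1 := by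
      rw [← Complex.ofReal_add, p.pMinus_add_pPlus, Complex.ofReal_one]
    linear_combination (-(p.pMinus : ℂ)) * e1 - (p.pPlus : ℂ) * e2 + (∑' n, a n) * e3

lemma evolved_succ (ρ : Op) (ω : Outcomes) (t : ℕ) :
    p.evolved ρ ω (t + 1) = p.step (ω t) (p.evolved ρ ω t) := by
  simp only [evolved, step, W]
  rw [show ContinuousLinearMap.adjoint (p.kraus (ω t) * p.W ω t) =
    ContinuousLinearMap.adjoint (p.W ω t) * ContinuousLinearMap.adjoint (p.kraus (ω t)) from
    ContinuousLinearMap.adjoint_comp _ _]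
  simp only [mul_assoc]

lemma W_congr {ω ω' : Outcomes} {t : ℕ} (h : ∀ i < t, ω i = ω' i) : p.W ω t = p.W ω' t := by
  induction t with
  | zero => rfl
  | succ t ih => rw [W, W, h t (Nat.lt_succ_self t), ih fun i hi => h i (hi.trans t.lt_succ_self)]

lemma isPositive_evolved (ρ : DensityOperator) (ω : Outcomes) (t : ℕ) :
    (p.evolved ρ.op ω t).IsPositive :=
  ρ.isPositive.conj_adjoint (p.W ω t)

lemma summable_evolved (ρ : DensityOperator) (ω : Outcomes) (t : ℕ) :
    Summable fun n => entry (p.evolved ρ.op ω t) n n := by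
  induction t with
  | zero =>
    have : p.evolved ρ.op ω 0 = ρ.op := by
      simp only [evolved, W]
      rw [show ContinuousLinearMap.adjoint (1 : Op) = 1 from ContinuousLinearMap.adjoint_id]
      simp
    rw [this]
    exact ρ.hasSum_entry.summable
  | succ t ih => rw [evolved_succ]; exact (sum_step ih).1 _

lemma trace_evolved_nonneg (ρ : DensityOperator) (ω : Outcomes) (t : ℕ) :
    0 ≤ (trace (p.evolved ρ.op ω t)).re := by
  rw [trace, Complex.re_tsum (p.summable_evolved ρ ω t)]
  exact tsum_nonneg fun n =>
    (Complex.le_def.1 ((p.isPositive_evolved ρ ω t).inner_nonneg_right (fock n))).1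

lemma weight_zero (ρ : DensityOperator) (ω : Outcomes) : p.weight ρ 0 ω = 1 := by
  have : p.evolved ρ.op ω 0 = ρ.op := by
    simp only [evolved, W]
    rw [show ContinuousLinearMap.adjoint (1 : Op) = 1 from ContinuousLinearMap.adjoint_id]
    simp
  rw [weight, this, trace, ρ.hasSum_entry.tsum_eq]
  simp

lemma weight_congr (ρ : DensityOperator) {ω ω' : Outcomes} {t : ℕ} (h : ∀ i < t, ω i = ω' i) :
    p.weight ρ t ω = p.weight ρ t ω' := by
  rw [weight, weight, evolved, evolved, p.W_congr h]

lemma sum_weight (ρ : DensityOperator) (t : ℕ) (ω : Outcomes) :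
    ∑ y, p.weight ρ (t + 1) (Function.update ω t y) = p.weight ρ t ω := by
  have h : ∀ y, p.evolved ρ.op (Function.update ω t y) (t + 1)
      = p.step y (p.evolved ρ.op ω t) := fun y => by
    rw [evolved_succ, Function.update_self, evolved, evolved,
      p.W_congr (ω' := ω) fun i hi => Function.update_of_ne hi.ne _ _]
  simp only [weight]
  rw [← ENNReal.ofReal_sum_of_nonneg fun y _ => p.trace_evolved_nonneg ρ _ _]
  simp only [h]
  rw [← Complex.re_sum, (sum_step (p.summable_evolved ρ ω t)).2]

end Params

/-! ### Extension of a consistent family of weights to a probability measure -/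

section Extension

variable {R : Type} [Fintype R] [Inhabited R] [DecidableEq R] [MeasurableSpace R]
  [MeasurableSingletonClass R]

/-- A finite history, continued in an arbitrary way. -/
def extend (n : ℕ) (h : (i : Finset.Iic n) → R) : ℕ → R :=
  fun i => if hi : i ∈ Finset.Iic n then h ⟨i, hi⟩ else default

/-- The conditional law of the next outcome given a finite history `h`, for consistent weights
`w`; histories of weight zero are irrelevant. -/
def nextLaw (w : ℕ → (ℕ → R) → ℝ≥0∞) (n : ℕ) (h : (i : Finset.Iic n) → R) : Measure R :=
  open Classical in
  if w (n + 1) (extend n h) = 0 ∨ w (n + 1) (extend n h) = ⊤ then Measure.dirac default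
  else ∑ y, (w (n + 2) (Function.update (extend n h) (n + 1) y) / w (n + 1) (extend n h)) •
    Measure.dirac y

/-- The law of the first outcome. -/
def firstLaw (w : ℕ → (ℕ → R) → ℝ≥0∞) : Measure R :=
  ∑ y, w 1 (Function.update (fun _ => default) 0 y) • Measure.dirac y

/-- Weights `w t ω` depending only on `ω 0, …, ω (t-1)` which are consistent. -/
structure Consistent (w : ℕ → (ℕ → R) → ℝ≥0∞) : Prop where
  zero : ∀ ω, w 0 ω = 1
  congr : ∀ t ω ω', (∀ i < t, ω i = ω' i) → w t ω = w t ω'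
  sum : ∀ t ω, ∑ y, w (t + 1) (Function.update ω t y) = w t ω

/-- The transition kernels of the process of outcomes. -/
def nextKernel (w : ℕ → (ℕ → R) → ℝ≥0∞) (n : ℕ) : Kernel ((i : Finset.Iic n) → R) R :=
  Kernel.ofFunOfCountable (nextLaw w n)

lemma sum_smul_dirac_apply {R : Type} [Fintype R] [MeasurableSpace R]
    [MeasurableSingletonClass R] (c : R → ℝ≥0∞) (s : Set R) :
    (∑ y, c y • Measure.dirac y : Measure R) s = ∑ y, c y * s.indicator 1 y := by
  simp [Measure.finsetSum_apply]

lemma Consistent.isProbabilityMeasure_firstLaw {w : ℕ → (ℕ → R) → ℝ≥0∞} (hw : Consistent w) :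
    IsProbabilityMeasure (firstLaw w) :=
  ⟨by rw [firstLaw, sum_smul_dirac_apply]; simpa [hw.zero] using hw.sum 0 fun _ => default⟩

lemma Consistent.isMarkovKernel {w : ℕ → (ℕ → R) → ℝ≥0∞} (hw : Consistent w) (n : ℕ) :
    IsMarkovKernel (nextKernel w n) := by
  refine ⟨fun h => ?_⟩
  change IsProbabilityMeasure (nextLaw w n h)
  unfold nextLaw
  split_ifs with h0
  · infer_instance
  · push Not at h0
    refine ⟨?_⟩
    rw [sum_smul_dirac_apply]
    simp only [Set.indicator_univ, Pi.one_apply, mul_one, div_eq_mul_inv]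
    rw [← Finset.sum_mul, hw.sum (n + 1)]
    exact ENNReal.mul_inv_cancel h0.1 h0.2

/-- The law of an infinite sequence of outcomes with prescribed consistent probabilities of finite
histories. -/
def pathMeasure (w : ℕ → (ℕ → R) → ℝ≥0∞) (hw : Consistent w) : Measure (ℕ → R) :=
  haveI := hw.isMarkovKernel
  Kernel.trajMeasure (X := fun _ => R) (firstLaw w) (nextKernel w)

instance {w : ℕ → (ℕ → R) → ℝ≥0∞} (hw : Consistent w) :
    IsProbabilityMeasure (pathMeasure w hw) := by
  have := hw.isMarkovKernel
  have := hw.isProbabilityMeasure_firstLaw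
  unfold pathMeasure
  infer_instance

lemma Consistent.le_one {w : ℕ → (ℕ → R) → ℝ≥0∞} (hw : Consistent w) (t : ℕ) (ω : ℕ → R) :
    w t ω ≤ 1 := by
  induction t with
  | zero => exact (hw.zero ω).le
  | succ t ih =>
    refine le_trans ?_ ih
    rw [← hw.sum t ω]
    conv_lhs => rw [← Function.update_eq_self t ω]
    exact Finset.single_le_sum (f := fun z => w (t + 1) (Function.update ω t z))
      (fun _ _ => zero_le) (Finset.mem_univ (ω t))

lemma pathMeasure_map {w : ℕ → (ℕ → R) → ℝ≥0∞} (hw : Consistent w) (n : ℕ) (y : ℕ → R) :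
    (pathMeasure w hw).map (Preorder.frestrictLe (π := fun _ => R) n)
      {Preorder.frestrictLe (π := fun _ => R) n y} = w (n + 1) y := by
  have := hw.isMarkovKernel
  have := hw.isProbabilityMeasure_firstLaw
  induction n with
  | zero =>
    have h : (pathMeasure w hw).map (Preorder.frestrictLe (π := fun _ => R) 0)
        = (firstLaw w).map (MeasurableEquiv.piUnique fun _ : Finset.Iic 0 => R).symm := by
      rw [pathMeasure, Kernel.trajMeasure, Measure.map_comp _ _ (by fun_prop),
        Kernel.traj_map_frestrictLe, Kernel.partialTraj_self, Measure.id_comp]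
    rw [h, MeasurableEquiv.map_apply]
    have h2 : (MeasurableEquiv.piUnique fun _ : Finset.Iic 0 => R).symm ⁻¹'
        {Preorder.frestrictLe (π := fun _ => R) 0 y} = {y 0} := by
      ext z
      simp only [Set.mem_preimage, Set.mem_singleton_iff]
      rw [MeasurableEquiv.symm_apply_eq]
      rfl
    rw [h2, firstLaw, sum_smul_dirac_apply, Finset.sum_eq_single (y 0)]
    · simp only [Set.mem_singleton_iff, Set.indicator_of_mem, Pi.one_apply, mul_one]
      exact hw.congr _ _ _ fun i hi => by
        obtain rfl : i = 0 := by omega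
        simp
    · intro b _ hb
      simp [hb]
    · simp
  | succ n ih =>
    have h := Kernel.map_frestrictLe_trajMeasure_compProd_eq_map_trajMeasure
      (X := fun _ => R) (μ₀ := firstLaw w) (κ := nextKernel w) (a := n)
    have h1 : (pathMeasure w hw).map (Preorder.frestrictLe (π := fun _ => R) (n + 1))
        {Preorder.frestrictLe (π := fun _ => R) (n + 1) y}
        = (pathMeasure w hw).map
          (fun x => (Preorder.frestrictLe (π := fun _ => R) n x, x (n + 1)))
          ({Preorder.frestrictLe (π := fun _ => R) n y} ×ˢ {y (n + 1)}) := by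
      rw [Measure.map_apply (by fun_prop) (measurableSet_singleton _),
        Measure.map_apply (by fun_prop)
          ((measurableSet_singleton _).prod (measurableSet_singleton _))]
      congr 1
      ext x
      simp only [Set.mem_preimage, Set.mem_singleton_iff, Set.mem_prod, funext_iff,
        Preorder.frestrictLe_apply, Subtype.forall, Finset.mem_Iic]
      constructor
      · exact fun hx => ⟨fun a ha => hx a (by omega), hx _ le_rfl⟩
      · rintro ⟨hx, hx'⟩ a ha
        rcases Nat.lt_or_ge a (n + 1) with h3 | h3
        · exact hx a (by omega)
        · obtain rfl : a = n + 1 := by omega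
          exact hx'
    rw [h1]
    have h' : (pathMeasure w hw).map
        (fun x => (Preorder.frestrictLe (π := fun _ => R) n x, x (n + 1))) =
        (pathMeasure w hw).map (Preorder.frestrictLe (π := fun _ => R) n) ⊗ₘ nextKernel w n :=
      h.symm
    have : IsProbabilityMeasure
        ((pathMeasure w hw).map (Preorder.frestrictLe (π := fun _ => R) n)) :=
      Measure.isProbabilityMeasure_map (by fun_prop)
    rw [h', Measure.compProd_apply_prod (measurableSet_singleton _) (measurableSet_singleton _),
      lintegral_singleton, ih]
    change nextLaw w n _ _ * _ = _
    have hext : ∀ i < n + 1, extend n (Preorder.frestrictLe (π := fun _ => R) n y) i = y i :=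
      fun i hi => by
        have : i ≤ n := by omega
        simp [extend, this]
    have hwe : w (n + 1) (extend n (Preorder.frestrictLe (π := fun _ => R) n y)) = w (n + 1) y :=
      hw.congr _ _ _ hext
    have hle : w (n + 2) y ≤ w (n + 1) y := by
      rw [← hw.sum (n + 1) y]
      conv_lhs => rw [← Function.update_eq_self (n + 1) y]
      exact Finset.single_le_sum (f := fun z => w (n + 1 + 1) (Function.update y (n + 1) z))
        (fun _ _ => zero_le) (Finset.mem_univ (y (n + 1)))
    have hne : w (n + 1) y ≠ ⊤ := ((hw.le_one _ _).trans_lt ENNReal.one_lt_top).ne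
    unfold nextLaw
    rw [hwe]
    by_cases h0 : w (n + 1) y = 0
    · rw [h0, mul_zero]
      exact (le_antisymm (h0 ▸ hle) zero_le).symm
    · rw [if_neg (by simp [h0, hne]), sum_smul_dirac_apply, Finset.sum_eq_single (y (n + 1))]
      · simp only [Set.mem_singleton_iff, Set.indicator_of_mem, Pi.one_apply, mul_one]
        rw [ENNReal.div_mul_cancel h0 hne]
        refine hw.congr _ _ _ fun i hi => ?_
        rcases Nat.lt_or_ge i (n + 1) with h3 | h3
        · rw [Function.update_of_ne h3.ne, hext i h3]
        · obtain rfl : i = n + 1 := by omega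
          simp
      · intro b _ hb
        simp [hb]
      · simp

/-- `pathMeasure` gives the cylinder of the sequences starting with `y 0, …, y (t-1)` the
probability `w t y`. -/
lemma pathMeasure_cylinder {w : ℕ → (ℕ → R) → ℝ≥0∞} (hw : Consistent w) (t : ℕ) (y : ℕ → R) :
    pathMeasure w hw {ω | ∀ i < t, ω i = y i} = w t y := by
  cases t with
  | zero => simp [hw.zero]
  | succ n =>
    rw [← pathMeasure_map hw n y,
      Measure.map_apply (by fun_prop) (measurableSet_singleton _)]
    congr 1
    ext ω
    simp only [Set.mem_setOf_eq, Set.mem_preimage, Set.mem_singleton_iff, funext_iff,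
      Preorder.frestrictLe_apply, Subtype.forall, Finset.mem_Iic, Nat.lt_succ_iff]

end Extension

/-! ### The measure on outcomes, the martingale `M_t` and the event `O` -/

namespace Params

variable (p : Params)

lemma consistent_weight (ρ : DensityOperator) : Consistent (p.weight ρ) where
  zero := p.weight_zero ρ
  congr _ _ _ h := p.weight_congr ρ h
  sum := p.sum_weight ρ

/-- The probability measure `ℙ^ρ` on the sequences of outcomes. -/
def outcomeMeasure (ρ : DensityOperator) : Measure Outcomes :=
  pathMeasure (p.weight ρ) (p.consistent_weight ρ)

instance (ρ : DensityOperator) : IsProbabilityMeasure (p.outcomeMeasure ρ) := by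
  unfold outcomeMeasure
  infer_instance

/-- The defining property of `ℙ^ρ`: the first `t` outcomes are `ω_1, …, ω_t` with probability
`Tr(W_t(ω) ρ W_t(ω)*)`. -/
lemma outcomeMeasure_cylinder (ρ : DensityOperator) (t : ℕ) (ω : Outcomes) :
    p.outcomeMeasure ρ {ω' | ∀ i < t, ω' i = ω i}
      = ENNReal.ofReal (trace (p.evolved ρ.op ω t)).re :=
  pathMeasure_cylinder (p.consistent_weight ρ) t ω

/-- `e^{-βεN}`, for `β > 0`. -/
def gibbs : Op := funN fun n => (Real.exp (-p.β * p.ε * n) : ℂ)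

/-- The Gibbs state `ρ_inv = e^{-βεN} / Tr e^{-βεN}`, for `β > 0`. -/
def rhoInv : Op := (trace p.gibbs)⁻¹ • p.gibbs

/-- `M_t = ρ_inv^{1/2} W_t* W_t ρ_inv^{1/2} / Tr(W_t* W_t ρ_inv)`. -/
def M (ω : Outcomes) (t : ℕ) : Op :=
  (trace (ContinuousLinearMap.adjoint (p.W ω t) * p.W ω t * p.rhoInv))⁻¹ •
    (sqrtOp p.rhoInv * ContinuousLinearMap.adjoint (p.W ω t) * p.W ω t * sqrtOp p.rhoInv)

/-- `M_∞(ω)`, the limit of `M_t(ω)` in trace norm (and `0` if there is no limit). -/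
def MInf (ω : Outcomes) : Op :=
  open Classical in if h : ∃ L, TendstoTraceNorm (p.M ω) L then h.choose else 0

/-- The set `R(ξ,η)` of Rabi resonances. -/
def resonances : Set ℕ := {n | 0 < n ∧ ∃ k : ℕ, 0 < k ∧ p.ξ * n + p.η = (k : ℝ) ^ 2}

/-- The system is degenerate: there are at least two one-dimensional Rabi sectors. -/
def IsDegenerate : Prop :=
  ∃ m n : ℕ, m ∈ {0} ∪ p.resonances ∧ n ∈ p.resonances ∧ m < n ∧
    m + 1 ∈ p.resonances ∧ n + 1 ∈ p.resonances

/-- The set `N(ξ,η)` of those `n` for which `{n}` is a Rabi sector. -/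
def oneDimSectors : Set ℕ := {n | n ∈ {0} ∪ p.resonances ∧ n + 1 ∈ p.resonances}

/-- The orthogonal projection `Q = ∑ |n⟩⟨n|`, the sum being over `n ∈ N(ξ,η)`. -/
def Q : Op := open Classical in funN fun n => if n ∈ p.oneDimSectors then 1 else 0

/-- The event `O = {M_∞ = Q ρ_inv Q / Tr(ρ_inv Q)}`. -/
def eventO : Set Outcomes :=
  {ω | p.MInf ω = (trace (p.rhoInv * p.Q))⁻¹ • (p.Q * p.rhoInv * p.Q)}

/-- `e^{-i(ετ+πξ)Ns}`. -/
def freeRotation (s : ℝ) : Op :=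
  funN fun n => Complex.exp (-Complex.I * ((p.ε * p.τ + Real.pi * p.ξ) * n * s : ℝ))

end Params

end Maser

end

noncomputable section

namespace Maser

/-! ### The trace norm and Hilbert-Schmidt norms -/

section Generic

variable {H : Type*} [NormedAddCommGroup H] [InnerProductSpace ℂ H] [CompleteSpace H]

/-! Write `N` for `oneDimSectors`. The operators `V₋₋`, `V₊₊` are functions of the number operator,
while `V₋₊`, `V₊₋` (jumps) move `|n⟩` by one with amplitudes proportional to `S(n)√n` and
`S(n+1)√(n+1)`. For `n ∈ N` both amplitudes vanish: a jump annihilates `|n⟩`, and in the absence of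
jumps `|n⟩` only acquires a phase, up to the probability of the incoming atoms. For `n ∉ N` at least
one of the two diagonal amplitudes has modulus less than one.

Hence `O` is, up to a null set, the event that no jump ever occurs. After a jump `M_t|n⟩ = 0` for
every `n ∈ N`, so that `M_∞` cannot be the normalized compression of the Gibbs state, which is
faithful; degeneracy enters by providing a point of `N` (`jumpless_of_mem_eventO`). If there is no
jump and both atomic states recur infinitely often, `W_t` is a scalar times `d_t(N)` with `|d_t| =
1` on `N` and `d_t → 0` elsewhere, so `M_t` converges in trace norm to that compression
(`goodOutcomes_subset_eventO`). The jumpless sequences left out are eventually constant: there are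
countably many, each of probability zero. This sandwich gives measurability and reduces the
probability of `O` to that of no jump. A system in `|n⟩` makes no jump in `t` steps with probability
`stay n ^ t`, where `stay n` equals one exactly on `N`; averaging over the populations of `ρ` and
letting `t → ∞` gives `Tr(ρQ)` (`outcomeMeasure_jumpless`).

The trajectory is handled by the same convergence result, `tendsto_traceNorm_conj`, applied to `ρ`
and the complex amplitudes. It remains to identify the phases on `N`. If `ξn+η = k²`, then `C(n) =
(-1)^k = (-1)^(k²) = e^{-iπ(ξn+η)}`, whose phase is affine in `n`: its constant part cancels in a
conjugation and its linear part is the rotation by `πξ`. At `n = 0` one has `C(0) = e^{iπ√η}`, which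
need not fit this pattern; therefore coherences between `0` and the rest of `N` require `√η` to be
an integer.

The analytic input is a combined triangle and Hölder inequality for the trace norm
(`traceNorm_sum_le`), which reduces trace norm convergence to dominated convergence on the
populations. -/

lemma sqrtOp_mul_self {T : H →L[ℂ] H} (hT : T.IsPositive) : sqrtOp T * sqrtOp T = T :=
  CFC.sqrt_mul_sqrt_self T (ContinuousLinearMap.nonneg_iff_isPositive _ |>.2 hT)

lemma sqrtOp_eq {S T : H →L[ℂ] H} (hS : S.IsPositive) (h : S * S = T) : sqrtOp T = S :=
  CFC.sqrt_unique h (ContinuousLinearMap.nonneg_iff_isPositive _ |>.2 hS)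

lemma isPositive_sqrtOp (T : H →L[ℂ] H) : (sqrtOp T).IsPositive :=
  ContinuousLinearMap.nonneg_iff_isPositive _ |>.1 (CFC.sqrt_nonneg T)

lemma isPositive_absOp (T : H →L[ℂ] H) : (absOp T).IsPositive :=
  ContinuousLinearMap.nonneg_iff_isPositive _ |>.1 (CFC.abs_nonneg T)

lemma norm_absOp (T : H →L[ℂ] H) : ‖absOp T‖ = ‖T‖ := by
  unfold absOp
  have h : CFC.abs T * CFC.abs T = star T * T := CFC.abs_mul_abs T
  have h1 := CStarRing.norm_star_mul_self (x := CFC.abs T)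
  have h2 := CStarRing.norm_star_mul_self (x := T)
  rw [(CFC.abs_nonneg T).isSelfAdjoint.star_eq, h, h2] at h1
  exact ((mul_self_inj (norm_nonneg _) (norm_nonneg _)).1 h1).symm

/-- An approximate polar decomposition. -/
lemma exists_contraction_absOp (T : H →L[ℂ] H) {δ : ℝ} (hδ : 0 < δ) :
    ∃ U : H →L[ℂ] H, ‖U‖ ≤ 1 ∧ ‖absOp T - ContinuousLinearMap.adjoint U * T‖ ≤ δ := by
  set A : H →L[ℂ] H := absOp T with hA
  have hA0 : 0 ≤ A := CFC.abs_nonneg T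
  have hspec : ∀ x ∈ spectrum ℝ A, 0 ≤ x := fun x hx => spectrum_nonneg_of_nonneg hA0 hx
  have hAA : A * A = star T * T := CFC.abs_mul_abs T
  have hne : ∀ x : ℝ, |x| + δ ≠ 0 := fun x => by positivity
  -- The absolute value only serves to make the function continuous on the whole line; the spectrum
  -- of `A` is nonnegative.
  have hcont : Continuous fun x : ℝ => (|x| + δ)⁻¹ :=
    (continuous_abs.add continuous_const).inv₀ hne
  set G : H →L[ℂ] H := cfc (fun x : ℝ => (|x| + δ)⁻¹) A with hG
  have hGsa : star G = G := (cfc_predicate (fun x : ℝ => (|x| + δ)⁻¹) A).star_eq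
  have hGA : G * (A * A) = cfc (fun x : ℝ => (|x| + δ)⁻¹ * (x * x)) A := by
    rw [cfc_mul (fun x : ℝ => (|x| + δ)⁻¹) (fun x => x * x) A hcont.continuousOn,
      cfc_mul (fun x : ℝ => x) (fun x => x) A, cfc_id' ℝ A]
  -- The contraction is `T(|T|+δ)⁻¹`. On the spectrum the two claims read `x²/(x+δ)² ≤ 1` and `x -
  -- x²/(x+δ) = δ·x/(x+δ) ≤ δ`.
  refine ⟨T * G, ?_, ?_⟩
  · have h1 : star (T * G) * (T * G) = cfc (fun x : ℝ => (|x| + δ)⁻¹ * (x * x) * (|x| + δ)⁻¹) A := by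
      rw [cfc_mul (fun x : ℝ => (|x| + δ)⁻¹ * (x * x)) (fun x => (|x| + δ)⁻¹) A
        (hcont.mul (continuous_id.mul continuous_id)).continuousOn hcont.continuousOn, ← hGA, hAA,
        star_mul, hGsa]
      simp only [mul_assoc, hG]
    have h2 : ‖star (T * G) * (T * G)‖ ≤ 1 := by
      rw [h1]
      refine norm_cfc_le zero_le_one fun x hx => ?_
      have hx0 := hspec x hx
      rw [abs_of_nonneg hx0, Real.norm_of_nonneg (by positivity)]
      have : (x + δ)⁻¹ * (x * x) * (x + δ)⁻¹ = (x * x) / ((x + δ) * (x + δ)) := by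
        field_simp
      rw [this, div_le_one (by positivity)]
      nlinarith
    rw [CStarRing.norm_star_mul_self] at h2
    nlinarith [norm_nonneg (T * G)]
  · have h1 : ContinuousLinearMap.adjoint (T * G) * T
        = cfc (fun x : ℝ => (|x| + δ)⁻¹ * (x * x)) A := by
      rw [← hGA, hAA, ← ContinuousLinearMap.star_eq_adjoint, star_mul, hGsa, mul_assoc]
    rw [h1]
    nth_rw 1 [← cfc_id' ℝ A]
    rw [← cfc_sub (fun x : ℝ => x) (fun x => (|x| + δ)⁻¹ * (x * x)) A continuousOn_id
      (hcont.mul (continuous_id.mul continuous_id)).continuousOn]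
    refine norm_cfc_le hδ.le fun x hx => ?_
    have hx0 := hspec x hx
    have : x - (|x| + δ)⁻¹ * (x * x) = δ * (x / (x + δ)) := by
      rw [abs_of_nonneg hx0]
      field_simp
      ring
    rw [this, Real.norm_of_nonneg (by positivity)]
    exact mul_le_of_le_one_right hδ.le ((div_le_one (by positivity)).2 (by linarith))

end Generic

/-! ### Matrix elements, Hilbert-Schmidt norms and the Hölder inequality -/

lemma enorm_sq_eq (x : FockSpace) : ‖x‖ₑ ^ 2 = ∑' n, ‖x n‖ₑ ^ 2 := by
  rw [← ofReal_norm, ← ENNReal.ofReal_pow (norm_nonneg _), norm_sq_eq,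
    ENNReal.ofReal_tsum_of_nonneg (fun n => by positivity) (summable_sq x)]
  simp only [ENNReal.ofReal_pow (norm_nonneg _), ofReal_norm]

lemma adjoint_fock_apply (T : Op) (n m : ℕ) :
    ContinuousLinearMap.adjoint T (fock n) m = (starRingEnd ℂ) (T (fock m) n) := by
  rw [← inner_fock_left, ContinuousLinearMap.adjoint_inner_right, ← inner_conj_symm,
    inner_fock_left]

/-- Since `⟨n, T x⟩ = ⟨T* n, x⟩`, it suffices to compare the adjoints on Fock vectors, and no
density argument is needed. -/
lemma op_ext {T T' : Op} (h : ∀ n m, entry T n m = entry T' n m) : T = T' := by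
  have h1 : ∀ n, ContinuousLinearMap.adjoint T (fock n)
      = ContinuousLinearMap.adjoint T' (fock n) := fun n => by
    ext m
    rw [adjoint_fock_apply, adjoint_fock_apply, ← entry_eq, ← entry_eq, h]
  ext x n
  rw [← inner_fock_left, ← inner_fock_left, ← ContinuousLinearMap.adjoint_inner_left,
    ← ContinuousLinearMap.adjoint_inner_left, h1]

/-- The square of the Hilbert-Schmidt norm. -/
def hsSq (X : Op) : ℝ≥0∞ := ∑' n, ‖X (fock n)‖ₑ ^ 2

lemma hsSq_adjoint (X : Op) : hsSq (ContinuousLinearMap.adjoint X) = hsSq X := by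
  simp only [hsSq, enorm_sq_eq]
  rw [ENNReal.tsum_comm]
  simp only [adjoint_fock_apply, ← ofReal_norm, RCLike.norm_conj]

lemma hsSq_mul_le {U : Op} (hU : ‖U‖ ≤ 1) (X : Op) : hsSq (U * X) ≤ hsSq X := by
  refine ENNReal.tsum_le_tsum fun n => ?_
  gcongr
  rw [mul_op_apply, enorm_le_iff_norm_le]
  simpa using U.le_of_opNorm_le hU (X (fock n))

/-- Cauchy-Schwarz in each coordinate gives `|(X x) n| ≤ ‖X* |n⟩‖ ‖x‖`; the squares sum to the
Hilbert-Schmidt norm of the adjoint. -/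
lemma norm_le_of_hsSq_le {X : Op} {c : ℝ} (hc : 0 ≤ c) (h : hsSq X ≤ ENNReal.ofReal (c ^ 2)) :
    ‖X‖ ≤ c := by
  refine ContinuousLinearMap.opNorm_le_bound _ hc fun x => ?_
  have key : ‖X x‖ₑ ^ 2 ≤ ENNReal.ofReal ((c * ‖x‖) ^ 2) := by
    rw [enorm_sq_eq, mul_pow, ENNReal.ofReal_mul (by positivity)]
    calc ∑' n, ‖X x n‖ₑ ^ 2
        ≤ ∑' n, ‖ContinuousLinearMap.adjoint X (fock n)‖ₑ ^ 2 * ENNReal.ofReal (‖x‖ ^ 2) := by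
          refine ENNReal.tsum_le_tsum fun n => ?_
          rw [← inner_fock_left, ← ContinuousLinearMap.adjoint_inner_left,
            ENNReal.ofReal_pow (norm_nonneg _), ofReal_norm, ← mul_pow]
          gcongr
          rw [← ofReal_norm, ← ofReal_norm, ← ofReal_norm, ← ENNReal.ofReal_mul (norm_nonneg _)]
          exact ENNReal.ofReal_le_ofReal (norm_inner_le_norm _ _)
      _ = hsSq X * ENNReal.ofReal (‖x‖ ^ 2) := by
          rw [ENNReal.tsum_mul_right, ← hsSq_adjoint X, hsSq]
      _ ≤ _ := by gcongr
  rw [← ofReal_norm, ← ENNReal.ofReal_pow (norm_nonneg _),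
    ENNReal.ofReal_le_ofReal_iff (by positivity)] at key
  exact le_of_sq_le_sq key (by positivity)

lemma adjoint_sqrtOp (T : Op) : ContinuousLinearMap.adjoint (sqrtOp T) = sqrtOp T :=
  (isPositive_sqrtOp T).isSelfAdjoint.adjoint_eq

lemma norm_sqrtOp_fock_sq {T : Op} (hT : T.IsPositive) (n : ℕ) :
    ‖sqrtOp T (fock n)‖ ^ 2 = (entry T n n).re := by
  have h : entry T n n = inner ℂ (sqrtOp T (fock n)) (sqrtOp T (fock n)) := by
    rw [entry]
    nth_rw 1 [← sqrtOp_mul_self hT]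
    rw [mul_op_apply, ← ContinuousLinearMap.adjoint_inner_left, adjoint_sqrtOp]
  rw [h, ← inner_self_eq_norm_sq (𝕜 := ℂ)]
  rfl

lemma hsSq_sqrtOp_absOp (T : Op) : hsSq (sqrtOp (absOp T)) = traceNorm T := by
  rw [hsSq, traceNorm]
  congr 1 with n
  rw [← norm_sqrtOp_fock_sq (isPositive_absOp T), ENNReal.ofReal_pow (norm_nonneg _), ofReal_norm]

/-- With `B = |T|^{1/2}`, `‖T‖ = ‖|T|‖ ≤ ‖B‖²`, and `‖B‖²` is at most the squared Hilbert-Schmidt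
norm of `B`, which is the trace norm. Trace norm limits are thus operator norm limits, hence unique.
-/
lemma ofReal_norm_le_traceNorm (T : Op) : ENNReal.ofReal ‖T‖ ≤ traceNorm T := by
  by_cases h : traceNorm T = ⊤
  · simp [h]
  have h1 : ‖sqrtOp (absOp T)‖ ≤ √(traceNorm T).toReal := by
    refine norm_le_of_hsSq_le (Real.sqrt_nonneg _) ?_
    rw [hsSq_sqrtOp_absOp, Real.sq_sqrt ENNReal.toReal_nonneg, ENNReal.ofReal_toReal h]
  refine ENNReal.ofReal_le_of_le_toReal ?_
  rw [← norm_absOp, ← sqrtOp_mul_self (isPositive_absOp T)]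
  calc _ ≤ ‖sqrtOp (absOp T)‖ * ‖sqrtOp (absOp T)‖ := norm_mul_le _ _
    _ ≤ √(traceNorm T).toReal * √(traceNorm T).toReal := by gcongr
    _ = _ := Real.mul_self_sqrt ENNReal.toReal_nonneg

lemma TendstoTraceNorm.tendsto {T : ℕ → Op} {L : Op} (h : TendstoTraceNorm T L) :
    Tendsto T atTop (𝓝 L) := by
  rw [tendsto_iff_norm_sub_tendsto_zero]
  have h1 : Tendsto (fun t => ENNReal.ofReal ‖T t - L‖) atTop (𝓝 0) :=
    tendsto_of_tendsto_of_tendsto_of_le_of_le tendsto_const_nhds h (fun _ => zero_le)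
      fun t => ofReal_norm_le_traceNorm _
  have h2 := (ENNReal.tendsto_toReal ENNReal.zero_ne_top).comp h1
  simpa [Function.comp_def, ENNReal.toReal_ofReal (norm_nonneg _)] using h2

lemma sum_enorm_inner_le (X Y : Op) (s : Finset ℕ) :
    ∑ n ∈ s, ‖inner ℂ (X (fock n)) (Y (fock n))‖ₑ
      ≤ hsSq X ^ (1 / 2 : ℝ) * hsSq Y ^ (1 / 2 : ℝ) := by
  calc _ ≤ ∑ n ∈ s, ‖X (fock n)‖ₑ * ‖Y (fock n)‖ₑ := by
        refine Finset.sum_le_sum fun n _ => ?_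
        rw [← ofReal_norm, ← ofReal_norm, ← ofReal_norm, ← ENNReal.ofReal_mul (norm_nonneg _)]
        exact ENNReal.ofReal_le_ofReal (norm_inner_le_norm _ _)
    _ ≤ _ := ENNReal.inner_le_Lp_mul_Lq _ _ _ Real.HolderConjugate.two_two
    _ ≤ _ := by
        simp only [ENNReal.rpow_two]
        gcongr <;> exact ENNReal.sum_le_tsum _

/-- Triangle and Hölder inequality for the trace norm. -/
lemma traceNorm_sum_le {ι : Type*} (s : Finset ι) (X Y : ι → Op) :
    traceNorm (∑ i ∈ s, X i * Y i)
      ≤ ∑ i ∈ s, hsSq (X i) ^ (1 / 2 : ℝ) * hsSq (Y i) ^ (1 / 2 : ℝ) := by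
  set T : Op := ∑ i ∈ s, X i * Y i with hT
  set B := ∑ i ∈ s, hsSq (X i) ^ (1 / 2 : ℝ) * hsSq (Y i) ^ (1 / 2 : ℝ) with hB
  rw [traceNorm, ENNReal.tsum_eq_iSup_sum]
  refine iSup_le fun K => ?_
  -- Replacing `|T|` by `U*T` costs at most `δ` per diagonal entry. On the finite set `K` this error
  -- vanishes as `δ → 0`, with a bound on the rest that does not depend on `K`.
  have key : ∀ δ : ℝ, 0 < δ →
      ∑ n ∈ K, ENNReal.ofReal (entry (absOp T) n n).re ≤ B + K.card * ENNReal.ofReal δ := by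
    intro δ hδ
    obtain ⟨U, hU, hUT⟩ := exists_contraction_absOp T hδ
    have hU' : ‖ContinuousLinearMap.adjoint U‖ ≤ 1 := by
      rwa [LinearIsometryEquiv.norm_map]
    have h1 : ∀ n, ENNReal.ofReal (entry (absOp T) n n).re ≤
        ∑ i ∈ s, ‖inner ℂ ((ContinuousLinearMap.adjoint (X i) * U) (fock n)) (Y i (fock n))‖ₑ
          + ENNReal.ofReal δ := fun n => by
      have hfock : ‖fock n‖ = 1 := by simp [fock, lp.norm_single]
      have e1 : entry (absOp T) n n = entry (ContinuousLinearMap.adjoint U * T) n n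
          + inner ℂ (fock n) ((absOp T - ContinuousLinearMap.adjoint U * T) (fock n)) := by
        simp only [entry, sub_apply, inner_sub_right]
        ring
      have e2 : ‖inner ℂ (fock n) ((absOp T - ContinuousLinearMap.adjoint U * T) (fock n))‖
          ≤ δ := by
        refine (norm_inner_le_norm _ _).trans ?_
        rw [hfock, one_mul]
        refine (ContinuousLinearMap.le_opNorm _ _).trans ?_
        rwa [hfock, mul_one]
      have e3 : entry (ContinuousLinearMap.adjoint U * T) n n = ∑ i ∈ s,
          inner ℂ ((ContinuousLinearMap.adjoint (X i) * U) (fock n)) (Y i (fock n)) := by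
        rw [entry, mul_op_apply, ContinuousLinearMap.adjoint_inner_right, hT]
        simp only [sum_apply, inner_sum, mul_op_apply,
          ContinuousLinearMap.adjoint_inner_left]
      have e4 : (entry (absOp T) n n).re ≤ ∑ i ∈ s,
          ‖inner ℂ ((ContinuousLinearMap.adjoint (X i) * U) (fock n)) (Y i (fock n))‖ + δ := by
        refine (Complex.re_le_norm _).trans ?_
        rw [e1, e3]
        exact (norm_add_le _ _).trans (add_le_add (norm_sum_le _ _) e2)
      refine (ENNReal.ofReal_le_ofReal e4).trans ?_
      rw [ENNReal.ofReal_add (Finset.sum_nonneg fun _ _ => norm_nonneg _) hδ.le,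
        ENNReal.ofReal_sum_of_nonneg fun _ _ => norm_nonneg _]
      simp only [ofReal_norm, le_refl]
    calc _ ≤ ∑ n ∈ K, (∑ i ∈ s,
          ‖inner ℂ ((ContinuousLinearMap.adjoint (X i) * U) (fock n)) (Y i (fock n))‖ₑ
            + ENNReal.ofReal δ) := Finset.sum_le_sum fun n _ => h1 n
      _ = ∑ i ∈ s, ∑ n ∈ K,
          ‖inner ℂ ((ContinuousLinearMap.adjoint (X i) * U) (fock n)) (Y i (fock n))‖ₑ
            + K.card * ENNReal.ofReal δ := by
          rw [Finset.sum_add_distrib, Finset.sum_comm, Finset.sum_const, nsmul_eq_mul]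
      _ ≤ _ := by
          refine add_le_add_left (Finset.sum_le_sum fun i _ => ?_) _
          refine (sum_enorm_inner_le _ _ _).trans ?_
          gcongr
          rw [← hsSq_adjoint, show ContinuousLinearMap.adjoint (ContinuousLinearMap.adjoint (X i) * U)
            = ContinuousLinearMap.adjoint U * ContinuousLinearMap.adjoint
              (ContinuousLinearMap.adjoint (X i)) from ContinuousLinearMap.adjoint_comp _ _,
            ContinuousLinearMap.adjoint_adjoint]
          exact hsSq_mul_le hU' _
  have hlim : Tendsto (fun δ : ℝ => B + K.card * ENNReal.ofReal δ) (𝓝[>] 0) (𝓝 (B + K.card * 0)) := by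
    refine tendsto_const_nhds.add (ENNReal.Tendsto.const_mul ?_ (Or.inr (by simp)))
    have := (ENNReal.continuous_ofReal.tendsto 0).mono_left (nhdsWithin_le_nhds (s := Set.Ioi 0))
    simpa using this
  rw [mul_zero, add_zero] at hlim
  exact ge_of_tendsto hlim (eventually_nhdsWithin_of_forall fun δ hδ => key δ hδ)

end Maser

end
noncomputable section

namespace Maser

/-! ### Functions of the number operator -/

section FunN

variable {f g : ℕ → ℂ} {K K' : ℝ}

lemma funN_fock (hf : ∀ n, ‖f n‖ ≤ K) (n : ℕ) : funN f (fock n) = f n • fock n := by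
  ext k
  rw [funN_apply hf, lp.coeFn_smul, Pi.smul_apply, fock_apply, smul_eq_mul]
  split_ifs with h
  · rw [h]
  · simp

lemma norm_conj_le (hf : ∀ n, ‖f n‖ ≤ K) (n : ℕ) : ‖(starRingEnd ℂ) (f n)‖ ≤ K := by
  rw [RCLike.norm_conj]
  exact hf n

lemma norm_mul_le_mul (hf : ∀ n, ‖f n‖ ≤ K) (hg : ∀ n, ‖g n‖ ≤ K') (n : ℕ) :
    ‖f n * g n‖ ≤ K * K' := by
  rw [norm_mul]
  exact mul_le_mul (hf n) (hg n) (norm_nonneg _) ((norm_nonneg _).trans (hf n))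

lemma adjoint_funN (hf : ∀ n, ‖f n‖ ≤ K) :
    ContinuousLinearMap.adjoint (funN f) = funN fun n => (starRingEnd ℂ) (f n) := by
  refine op_ext fun n m => ?_
  rw [entry_eq, entry_eq, adjoint_fock_apply, funN_apply hf, funN_apply (norm_conj_le hf),
    fock_apply, fock_apply]
  by_cases h : n = m
  · simp [h]
  · simp [h, Ne.symm h]

lemma funN_mul_funN (hf : ∀ n, ‖f n‖ ≤ K) (hg : ∀ n, ‖g n‖ ≤ K') :
    funN f * funN g = funN fun n => f n * g n := by
  ext x n
  rw [mul_op_apply, funN_apply hf, funN_apply hg, funN_apply (norm_mul_le_mul hf hg), mul_assoc]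

lemma smul_funN (c : ℂ) (hf : ∀ n, ‖f n‖ ≤ K) : c • funN f = funN fun n => c * f n := by
  have h : ∀ n, ‖c * f n‖ ≤ ‖c‖ * K := fun n => by
    rw [norm_mul]
    gcongr
    exact hf n
  ext x n
  rw [smul_op_apply, funN_apply hf, funN_apply h, mul_assoc]

lemma entry_smul (c : ℂ) (T : Op) (n m : ℕ) : entry (c • T) n m = c * entry T n m := by
  rw [entry_eq, entry_eq, smul_op_apply]

lemma entry_funN_mul (hf : ∀ n, ‖f n‖ ≤ K) (T : Op) (n m : ℕ) :
    entry (funN f * T) n m = f n * entry T n m := by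
  rw [entry_eq, entry_eq, mul_op_apply, funN_apply hf]

lemma entry_mul_funN (hf : ∀ n, ‖f n‖ ≤ K) (T : Op) (n m : ℕ) :
    entry (T * funN f) n m = entry T n m * f m := by
  rw [entry_eq, entry_eq, mul_op_apply, funN_fock hf, map_smul, lp.coeFn_smul, Pi.smul_apply,
    smul_eq_mul, mul_comm]

lemma entry_funN (hf : ∀ n, ‖f n‖ ≤ K) (n : ℕ) : entry (funN f) n n = f n := by
  rw [entry_eq, funN_apply hf, fock_apply]
  simp

lemma isPositive_funN (hf : ∀ n, ‖f n‖ ≤ K) (h0 : ∀ n, ∃ r : ℝ, 0 ≤ r ∧ f n = (r : ℂ)) :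
    (funN f).IsPositive := by
  choose r hr hfr using h0
  have hb : ∀ n, ‖((√(r n) : ℝ) : ℂ)‖ ≤ √K := fun n => by
    rw [Complex.norm_real, Real.norm_of_nonneg (Real.sqrt_nonneg _)]
    refine Real.sqrt_le_sqrt ((le_of_eq ?_).trans (hf n))
    rw [hfr, Complex.norm_real, Real.norm_of_nonneg (hr n)]
  have h : funN f = ContinuousLinearMap.adjoint (funN fun n => ((√(r n) : ℝ) : ℂ))
      * funN fun n => ((√(r n) : ℝ) : ℂ) := by
    rw [adjoint_funN hb, funN_mul_funN (norm_conj_le hb) hb]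
    congr 1 with n
    rw [hfr, Complex.conj_ofReal, ← Complex.ofReal_mul, Real.mul_self_sqrt (hr n)]
  rw [h]
  exact ContinuousLinearMap.isPositive_adjoint_comp_self _

/-- The orthogonal projection onto the closed span of the `|n⟩`, `n ∈ N`. -/
def proj (N : Set ℕ) : Op := open Classical in funN fun n => if n ∈ N then 1 else 0

lemma proj_eq (N : Set ℕ) [DecidablePred (· ∈ N)] :
    proj N = funN fun n => if n ∈ N then 1 else 0 := by
  unfold proj
  congr 1 with n
  congr

end FunN

/-! ### Conjugation of a density operator by functions of the number operator -/

namespace DensityOperator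

variable (ρ : DensityOperator) {f g : ℕ → ℂ} {K K' : ℝ}

/-- The population `⟨n, ρ n⟩`. -/
def pop (n : ℕ) : ℝ := (entry ρ.op n n).re

lemma pop_nonneg (n : ℕ) : 0 ≤ ρ.pop n :=
  (Complex.le_def.1 (ρ.isPositive.inner_nonneg_right (fock n))).1

lemma entry_self (n : ℕ) : entry ρ.op n n = ρ.pop n :=
  Complex.ext rfl (Complex.le_def.1 (ρ.isPositive.inner_nonneg_right (fock n))).2.symm

lemma hasSum_pop : HasSum ρ.pop 1 := by
  have := Complex.hasSum_re ρ.hasSum_entry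
  rwa [Complex.one_re] at this

lemma entry_conj (n m : ℕ) : (starRingEnd ℂ) (entry ρ.op n m) = entry ρ.op m n := by
  rw [entry, inner_conj_symm, entry]
  nth_rw 1 [← ρ.isPositive.isSelfAdjoint.adjoint_eq]
  rw [ContinuousLinearMap.adjoint_inner_left]

/-- `∑ₙ |f(n)|² ⟨n, ρ n⟩`. -/
def meanSq (f : ℕ → ℂ) : ℝ := ∑' n, ‖f n‖ ^ 2 * ρ.pop n

lemma sq_mul_pop_le (hf : ∀ n, ‖f n‖ ≤ K) (n : ℕ) :
    ‖f n‖ ^ 2 * ρ.pop n ≤ K ^ 2 * ρ.pop n := by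
  have := ρ.pop_nonneg n
  gcongr
  exact hf n

lemma summable_sq_mul_pop (hf : ∀ n, ‖f n‖ ≤ K) : Summable fun n => ‖f n‖ ^ 2 * ρ.pop n :=
  Summable.of_nonneg_of_le (fun n => mul_nonneg (by positivity) (ρ.pop_nonneg n))
    (ρ.sq_mul_pop_le hf) (ρ.hasSum_pop.summable.mul_left (K ^ 2))

lemma meanSq_nonneg (f : ℕ → ℂ) : 0 ≤ ρ.meanSq f :=
  tsum_nonneg fun n => mul_nonneg (by positivity) (ρ.pop_nonneg n)

lemma meanSq_le_one (hf : ∀ n, ‖f n‖ ≤ 1) : ρ.meanSq f ≤ 1 := by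
  rw [meanSq, ← ρ.hasSum_pop.tsum_eq]
  refine (ρ.summable_sq_mul_pop hf).tsum_le_tsum (fun n => ?_) ρ.hasSum_pop.summable
  simpa using ρ.sq_mul_pop_le hf n

lemma meanSq_const_mul (c : ℂ) (f : ℕ → ℂ) : ρ.meanSq (fun n => c * f n) = ‖c‖ ^ 2 * ρ.meanSq f := by
  simp only [meanSq, norm_mul, mul_pow, mul_assoc, tsum_mul_left]

lemma meanSq_conj (f : ℕ → ℂ) : ρ.meanSq (fun n => (starRingEnd ℂ) (f n)) = ρ.meanSq f := by
  simp only [meanSq, RCLike.norm_conj]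

/-- Dominated convergence with the populations as summable majorant. Only the moduli have to
converge, so that the phases may rotate freely. -/
lemma tendsto_meanSq {d : ℕ → ℕ → ℂ} (hd : ∀ t n, ‖d t n‖ ≤ 1)
    (h : ∀ n, Tendsto (fun t => ‖d t n‖) atTop (𝓝 ‖f n‖)) :
    Tendsto (fun t => ρ.meanSq (d t)) atTop (𝓝 (ρ.meanSq f)) := by
  refine tendsto_tsum_of_dominated_convergence ρ.hasSum_pop.summable
    (fun n => ((h n).pow 2).mul_const _) (Eventually.of_forall fun t n => ?_)
  rw [Real.norm_of_nonneg (mul_nonneg (by positivity) (ρ.pop_nonneg n))]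
  simpa using ρ.sq_mul_pop_le (hd t) n

lemma trace_conj (hf : ∀ n, ‖f n‖ ≤ K) :
    trace (funN f * ρ.op * ContinuousLinearMap.adjoint (funN f)) = ρ.meanSq f := by
  rw [trace, meanSq, Complex.ofReal_tsum]
  congr 1 with n
  rw [adjoint_funN hf, entry_mul_funN (norm_conj_le hf), entry_funN_mul hf, entry_self,
    mul_right_comm, Complex.mul_conj, Complex.normSq_eq_norm_sq]
  push_cast
  rfl

lemma norm_ite_le (N : Set ℕ) [DecidablePred (· ∈ N)] (n : ℕ) :
    ‖(if n ∈ N then 1 else 0 : ℂ)‖ ≤ 1 := by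
  split_ifs <;> simp

lemma trace_mul_proj (N : Set ℕ) [DecidablePred (· ∈ N)] :
    trace (ρ.op * proj N) = ρ.meanSq fun n => if n ∈ N then 1 else 0 := by
  rw [trace, meanSq, Complex.ofReal_tsum, proj_eq]
  congr 1 with n
  rw [ entry_mul_funN (norm_ite_le N), entry_self]
  split_ifs <;> simp

lemma hsSq_sqrtOp_mul_funN (hf : ∀ n, ‖f n‖ ≤ K) :
    hsSq (sqrtOp ρ.op * funN f) = ENNReal.ofReal (ρ.meanSq f) := by
  rw [hsSq, meanSq, ENNReal.ofReal_tsum_of_nonneg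
    (fun n => mul_nonneg (by positivity) (ρ.pop_nonneg n)) (ρ.summable_sq_mul_pop hf)]
  congr 1 with n
  rw [mul_op_apply, funN_fock hf, map_smul, pop, ← norm_sqrtOp_fock_sq ρ.isPositive, ← mul_pow,
    ← norm_smul, ENNReal.ofReal_pow (norm_nonneg _), ofReal_norm]

lemma hsSq_funN_mul_sqrtOp (hf : ∀ n, ‖f n‖ ≤ K) :
    hsSq (funN f * sqrtOp ρ.op) = ENNReal.ofReal (ρ.meanSq f) := by
  rw [← hsSq_adjoint, show ContinuousLinearMap.adjoint (funN f * sqrtOp ρ.op)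
    = ContinuousLinearMap.adjoint (sqrtOp ρ.op) * ContinuousLinearMap.adjoint (funN f) from
    ContinuousLinearMap.adjoint_comp _ _, adjoint_sqrtOp, adjoint_funN hf,
    hsSq_sqrtOp_mul_funN _ (norm_conj_le hf), meanSq_conj]

/-- Factoring `ρ = √ρ √ρ` makes every term a product of two Hilbert-Schmidt operators, whose norms
involve only the populations of `ρ`; the coherences never have to be estimated. -/
lemma traceNorm_sum_conj_le {ι : Type*} (s : Finset ι) {F G : ι → ℕ → ℂ}
    (hF : ∀ i, ∃ K : ℝ, ∀ n, ‖F i n‖ ≤ K) (hG : ∀ i, ∃ K : ℝ, ∀ n, ‖G i n‖ ≤ K) :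
    traceNorm (∑ i ∈ s, funN (F i) * ρ.op * funN (G i))
      ≤ ENNReal.ofReal (∑ i ∈ s, √(ρ.meanSq (F i)) * √(ρ.meanSq (G i))) := by
  choose K hK using hF
  choose K' hK' using hG
  have h : ∀ i, funN (F i) * ρ.op * funN (G i)
      = (funN (F i) * sqrtOp ρ.op) * (sqrtOp ρ.op * funN (G i)) := fun i => by
    nth_rw 1 [← sqrtOp_mul_self ρ.isPositive]
    simp only [mul_assoc]
  simp only [h]
  refine (traceNorm_sum_le s _ _).trans (le_of_eq ?_)
  rw [ENNReal.ofReal_sum_of_nonneg fun i _ => mul_nonneg (Real.sqrt_nonneg _) (Real.sqrt_nonneg _)]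
  refine Finset.sum_congr rfl fun i _ => ?_
  rw [hsSq_funN_mul_sqrtOp _ (hK i), hsSq_sqrtOp_mul_funN _ (hK' i),
    ENNReal.ofReal_rpow_of_nonneg (ρ.meanSq_nonneg _) (by norm_num),
    ENNReal.ofReal_rpow_of_nonneg (ρ.meanSq_nonneg _) (by norm_num),
    ← ENNReal.ofReal_mul (Real.rpow_nonneg (ρ.meanSq_nonneg _) _), Real.sqrt_eq_rpow, Real.sqrt_eq_rpow]

/-- If contractions `D_t = d_t(N)` are isometric on the span of the `|n⟩`, `n ∈ N`, and converge
strongly to zero on its orthogonal complement, then the normalized conjugation by `D_t` is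
asymptotic to that of the compression to this span. -/
lemma tendsto_traceNorm_conj {N : Set ℕ} {d : ℕ → ℕ → ℂ} (hd : ∀ t n, ‖d t n‖ ≤ 1)
    (hN : ∀ n ∈ N, ∀ t, ‖d t n‖ = 1)
    (hN' : ∀ n ∉ N, Tendsto (fun t => ‖d t n‖) atTop (𝓝 0))
    (hρ : trace (ρ.op * proj N) ≠ 0) :
    Tendsto (fun t => traceNorm
      ((trace (funN (d t) * ρ.op * ContinuousLinearMap.adjoint (funN (d t))))⁻¹ •
        (funN (d t) * ρ.op * ContinuousLinearMap.adjoint (funN (d t)))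
      - funN (d t) * ((trace (ρ.op * proj N))⁻¹ • (proj N * ρ.op * proj N))
        * ContinuousLinearMap.adjoint (funN (d t)))) atTop (𝓝 0) := by
  classical
  set q : ℕ → ℂ := fun n => if n ∈ N then 1 else 0 with hq
  have hq1 : ∀ n, ‖q n‖ ≤ 1 := norm_ite_le N
  have hproj : proj N = funN q := proj_eq N
  set a : ℕ → ℕ → ℂ := fun t n => if n ∈ N then d t n else 0 with ha
  set b : ℕ → ℕ → ℂ := fun t n => if n ∈ N then 0 else d t n with hb
  have ha1 : ∀ t n, ‖a t n‖ ≤ 1 := fun t n => by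
    simp only [ha]; split_ifs
    · exact hd t n
    · simp
  have hb1 : ∀ t n, ‖b t n‖ ≤ 1 := fun t n => by
    simp only [hb]; split_ifs
    · simp
    · exact hd t n
  have hκ : trace (ρ.op * proj N) = ρ.meanSq q := ρ.trace_mul_proj N
  have hq0 : ρ.meanSq q ≠ 0 := fun h => hρ (by rw [hκ, h, Complex.ofReal_zero])
  have hlim_d : Tendsto (fun t => ρ.meanSq (d t)) atTop (𝓝 (ρ.meanSq q)) := by
    refine ρ.tendsto_meanSq hd fun n => ?_
    by_cases h : n ∈ N
    · simp [hq, h, hN n h]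
    · simpa [hq, h] using hN' n h
  have hlim_b : Tendsto (fun t => ρ.meanSq (b t)) atTop (𝓝 0) := by
    have h0 : ρ.meanSq 0 = 0 := by simp [meanSq]
    rw [← h0]
    refine ρ.tendsto_meanSq hb1 fun n => ?_
    by_cases h : n ∈ N
    · simp [hb, h]
    · simpa [hb, h] using hN' n h
  set κ : ℂ := (((ρ.meanSq q)⁻¹ : ℝ) : ℂ) with hκ'
  set k : ℕ → ℂ := fun t => (((ρ.meanSq (d t))⁻¹ : ℝ) : ℂ) with hk
  -- With `d = a + b`, where `a` lives on `N` and `b` off `N`, the difference is `k bρd* + k aρb* +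
  -- (k - κ) aρa*`. The first two terms are small because `b` vanishes in mean square, the third
  -- because the normalizations converge.
  let F : ℕ → Fin 3 → ℕ → ℂ := fun t =>
    ![fun n => k t * b t n, fun n => k t * a t n, fun n => (k t - κ) * a t n]
  let G : ℕ → Fin 3 → ℕ → ℂ := fun t =>
    ![fun n => (starRingEnd ℂ) (d t n), fun n => (starRingEnd ℂ) (b t n),
      fun n => (starRingEnd ℂ) (a t n)]
  have hbd : ∀ (c : ℂ) {f : ℕ → ℂ}, (∀ n, ‖f n‖ ≤ 1) → ∀ n, ‖c * f n‖ ≤ ‖c‖ := fun c f hf n => by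
    rw [norm_mul]
    exact mul_le_of_le_one_right (norm_nonneg _) (hf n)
  have hF : ∀ t i, ∃ K : ℝ, ∀ n, ‖F t i n‖ ≤ K := fun t i => by
    fin_cases i
    exacts [⟨_, hbd _ (hb1 t)⟩, ⟨_, hbd _ (ha1 t)⟩, ⟨_, hbd _ (ha1 t)⟩]
  have hG : ∀ t i, ∃ K : ℝ, ∀ n, ‖G t i n‖ ≤ K := fun t i => by
    fin_cases i
    exacts [⟨_, norm_conj_le (hd t)⟩, ⟨_, norm_conj_le (hb1 t)⟩, ⟨_, norm_conj_le (ha1 t)⟩]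
  have hdecomp : ∀ t, (trace (funN (d t) * ρ.op * ContinuousLinearMap.adjoint (funN (d t))))⁻¹ •
        (funN (d t) * ρ.op * ContinuousLinearMap.adjoint (funN (d t)))
      - funN (d t) * ((trace (ρ.op * proj N))⁻¹ • (proj N * ρ.op * proj N))
        * ContinuousLinearMap.adjoint (funN (d t))
      = ∑ i, funN (F t i) * ρ.op * funN (G t i) := fun t => by
    have e : ∀ A B : Op, ∀ n m, entry (A + B) n m = entry A n m + entry B n m := fun A B n m => by
      rw [entry_eq, entry_eq, entry_eq]; rfl
    have e' : ∀ A B : Op, ∀ n m, entry (A - B) n m = entry A n m - entry B n m := fun A B n m => by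
      rw [entry_eq, entry_eq, entry_eq]; rfl
    rw [ρ.trace_conj (hd t), hκ, hproj, adjoint_funN (hd t), Fin.sum_univ_three]
    refine op_ext fun n m => ?_
    simp only [F, G, Matrix.cons_val_zero, Matrix.cons_val_one, Matrix.cons_val]
    rw [e, e, e', entry_smul, entry_mul_funN (norm_conj_le (hd t)), entry_funN_mul (hd t),
      entry_mul_funN (norm_conj_le (hd t)), entry_funN_mul (hd t), entry_smul,
      entry_mul_funN hq1, entry_funN_mul hq1,
      entry_mul_funN (norm_conj_le (hd t)), entry_funN_mul (hbd _ (hb1 t)),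
      entry_mul_funN (norm_conj_le (hb1 t)), entry_funN_mul (hbd _ (ha1 t)),
      entry_mul_funN (norm_conj_le (ha1 t)), entry_funN_mul (hbd _ (ha1 t))]
    simp only [hq, ha, hb, hκ', hk, Complex.ofReal_inv]
    split_ifs <;> simp <;> ring
  simp only [hdecomp]
  have hbound : Tendsto (fun t => ENNReal.ofReal (2 * (‖k t‖ * √(ρ.meanSq (b t))) + ‖k t - κ‖))
      atTop (𝓝 0) := by
    have hk_lim : Tendsto k atTop (𝓝 κ) :=
      (Complex.continuous_ofReal.tendsto _).comp (hlim_d.inv₀ hq0)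
    have h1 := ((hk_lim.norm.mul hlim_b.sqrt).const_mul 2).add (hk_lim.sub_const κ).norm
    have h2 := ENNReal.tendsto_ofReal h1
    simpa using h2
  refine tendsto_of_tendsto_of_tendsto_of_le_of_le tendsto_const_nhds hbound
    (fun _ => zero_le) fun t => ?_
  refine (ρ.traceNorm_sum_conj_le Finset.univ (hF t) (hG t)).trans (ENNReal.ofReal_le_ofReal ?_)
  rw [Fin.sum_univ_three]
  simp only [F, G, Matrix.cons_val_zero, Matrix.cons_val_one, Matrix.cons_val]
  simp only [meanSq_conj, meanSq_const_mul, Real.sqrt_mul (sq_nonneg _),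
    Real.sqrt_sq (norm_nonneg _)]
  have sd : √(ρ.meanSq (d t)) ≤ 1 := Real.sqrt_le_one.2 (ρ.meanSq_le_one (hd t))
  have sa : √(ρ.meanSq (a t)) ≤ 1 := Real.sqrt_le_one.2 (ρ.meanSq_le_one (ha1 t))
  have i1 : ‖k t‖ * √(ρ.meanSq (b t)) * √(ρ.meanSq (d t)) ≤ ‖k t‖ * √(ρ.meanSq (b t)) :=
    mul_le_of_le_one_right (by positivity) sd
  have i2 : ‖k t‖ * √(ρ.meanSq (a t)) * √(ρ.meanSq (b t)) ≤ ‖k t‖ * √(ρ.meanSq (b t)) := by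
    rw [mul_right_comm]
    exact mul_le_of_le_one_right (by positivity) sa
  have i3 : ‖k t - κ‖ * √(ρ.meanSq (a t)) * √(ρ.meanSq (a t)) ≤ ‖k t - κ‖ := by
    rw [mul_assoc]
    exact mul_le_of_le_one_right (norm_nonneg _) (mul_le_one₀ sa (Real.sqrt_nonneg _) sa)
  linarith

end DensityOperator

end Maser

end
noncomputable section

namespace Maser

/-! ### Scalars under normalization, and products tending to zero -/

lemma trace_smul (c : ℂ) (T : Op) : trace (c • T) = c * trace T := by
  simp only [trace, entry_smul, tsum_mul_left]

lemma normalize_smul {c : ℂ} (hc : c ≠ 0) (T : Op) :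
    (trace (c • T))⁻¹ • (c • T) = (trace T)⁻¹ • T := by
  rw [trace_smul, smul_smul, mul_inv, mul_right_comm, inv_mul_cancel₀ hc, one_mul]

lemma smul_conj_smul (c : ℂ) (D A : Op) :
    (c • D) * A * ContinuousLinearMap.adjoint (c • D)
      = ((‖c‖ ^ 2 : ℝ) : ℂ) • (D * A * ContinuousLinearMap.adjoint D) := by
  rw [map_smulₛₗ, smul_mul_assoc, smul_mul_assoc, mul_smul_comm, smul_smul, Complex.mul_conj,
    Complex.normSq_eq_norm_sq]

/-- The partial products decrease, and each occurrence of the value `x < 1` multiplies them by `x`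
once more. -/
lemma tendsto_prod_zero {f : ℕ → ℝ} (h0 : ∀ i, 0 ≤ f i) (h1 : ∀ i, f i ≤ 1) {x : ℝ} (hx : x < 1)
    (h : ∃ᶠ i in atTop, f i = x) :
    Tendsto (fun t => ∏ i ∈ Finset.range t, f i) atTop (𝓝 0) := by
  have hx0 : 0 ≤ x := by
    obtain ⟨i, hi⟩ := h.exists
    exact hi ▸ h0 i
  have hanti : Antitone fun t => ∏ i ∈ Finset.range t, f i := antitone_nat_of_succ_le fun t => by
    rw [Finset.prod_range_succ]
    exact mul_le_of_le_one_right (Finset.prod_nonneg fun i _ => h0 i) (h1 t)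
  have hk : ∀ k : ℕ, ∃ T, ∏ i ∈ Finset.range T, f i ≤ x ^ k := fun k => by
    induction k with
    | zero => exact ⟨0, by simp⟩
    | succ k ih =>
      obtain ⟨T, hT⟩ := ih
      obtain ⟨i, hi, hfi⟩ := (frequently_atTop.1 h) T
      refine ⟨i + 1, ?_⟩
      rw [Finset.prod_range_succ, hfi, pow_succ]
      exact mul_le_mul_of_nonneg_right ((hanti hi).trans hT) hx0
  refine tendsto_order.2 ⟨fun a ha => Eventually.of_forall fun t =>
    ha.trans_le (Finset.prod_nonneg fun i _ => h0 i), fun a ha => ?_⟩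
  obtain ⟨k, hka⟩ := exists_pow_lt_of_lt_one ha hx
  obtain ⟨T, hT⟩ := hk k
  filter_upwards [eventually_ge_atTop T] with t ht
  exact ((hanti ht).trans hT).trans_lt hka

namespace Params

variable (p : Params)

/-! ### Amplitudes -/

lemma pMinus_pos : 0 < p.pMinus := by unfold pMinus; positivity

lemma pPlus_pos : 0 < p.pPlus := by unfold pPlus; positivity

/-- The probability that an atom enters in the given state. -/
def prob : Bool → ℝ
  | false => p.pMinus
  | true => p.pPlus

/-- The amplitude of `|n⟩ → |n⟩` when the state of the atom does not change. -/
def amp : Bool → ℕ → ℂ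
  | false, n => Complex.exp (-Complex.I * (p.τ * p.ε * n : ℝ)) * p.C n
  | true, n => Complex.exp (-Complex.I * (p.τ * p.ε * n : ℝ)) * (starRingEnd ℂ) (p.C (n + 1))

lemma prob_pos (b : Bool) : 0 < p.prob b := by
  cases b
  exacts [p.pMinus_pos, p.pPlus_pos]

lemma sum_prob : ∑ b, p.prob b = 1 := by
  rw [Fintype.sum_bool, add_comm]
  exact p.pMinus_add_pPlus

lemma prob_lt_one (b : Bool) : p.prob b < 1 := by
  have h := p.pMinus_add_pPlus
  have := p.pMinus_pos
  have := p.pPlus_pos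
  cases b
  · change p.pMinus < 1; linarith
  · change p.pPlus < 1; linarith

lemma norm_amp_false (n : ℕ) : ‖p.amp false n‖ = ‖p.C n‖ := by
  rw [amp, norm_mul, norm_exp_phase, one_mul]

lemma norm_amp_true (n : ℕ) : ‖p.amp true n‖ = ‖p.C (n + 1)‖ := by
  rw [amp, norm_mul, norm_exp_phase, one_mul, RCLike.norm_conj]

lemma norm_amp_le (b : Bool) (n : ℕ) : ‖p.amp b n‖ ≤ 1 := by
  cases b
  · rw [norm_amp_false]; exact p.norm_C_le n
  · rw [norm_amp_true]; exact p.norm_C_le _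

lemma kraus_diag (b : Bool) : p.kraus (b, b) = (√(p.prob b) : ℂ) • funN (p.amp b) := by
  ext x n
  rw [smul_op_apply, funN_apply (p.norm_amp_le b)]
  cases b
  · rw [kraus_mm_apply]; simp only [prob, amp]; ring
  · rw [kraus_pp_apply]; simp only [prob, amp]; ring

lemma sin_rabi_of_mem {n : ℕ} (h : n ∈ p.resonances) : Real.sin (Real.pi * p.rabi n) = 0 := by
  obtain ⟨-, k, -, hk⟩ := h
  rw [rabi, hk, Real.sqrt_sq (Nat.cast_nonneg k), mul_comm, Real.sin_nat_mul_pi]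

lemma S_mul_sqrt_eq_zero {n : ℕ} (h : n ∈ {0} ∪ p.resonances) : p.S n * √(n : ℝ) = 0 := by
  rcases h with h | h
  · rw [Set.mem_singleton_iff] at h
    simp [h]
  · rw [S, p.sin_rabi_of_mem h]
    simp

/-- A zero of `sin(πr)` with `r = √(ξn+η) > 0` forces `r` to be a positive integer, that is, a
resonance. -/
lemma S_mul_sqrt_ne_zero {n : ℕ} (h : n ∉ {0} ∪ p.resonances) : p.S n * √(n : ℝ) ≠ 0 := by
  rw [Set.mem_union, Set.mem_singleton_iff, not_or] at h
  obtain ⟨hn, hR⟩ := h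
  have hn' : (0 : ℝ) < n := by exact_mod_cast Nat.pos_of_ne_zero hn
  have hrabi : 0 < p.rabi n :=
    Real.sqrt_pos.2 (add_pos_of_pos_of_nonneg (mul_pos p.ξ_pos hn') p.η_nonneg)
  have hsin : Real.sin (Real.pi * p.rabi n) ≠ 0 := fun h0 => by
    obtain ⟨k, hk⟩ := Real.sin_eq_zero_iff.1 h0
    have hk' : p.rabi n = k := by
      have := Real.pi_ne_zero
      have h1 : Real.pi * (p.rabi n - k) = 0 := by linarith
      rcases mul_eq_zero.1 h1 with h2 | h2
      · exact absurd h2 this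
      · linarith
    have hk0 : 0 < k := by
      rw [hk'] at hrabi
      exact_mod_cast hrabi
    refine hR ⟨Nat.pos_of_ne_zero hn, k.toNat, by omega, ?_⟩
    rw [← p.rabi_sq n, hk']
    congr 1
    exact_mod_cast (Int.toNat_of_nonneg hk0.le).symm
  have hξ := Real.sqrt_pos.2 p.ξ_pos
  exact mul_ne_zero (mul_ne_zero hξ.ne' (div_ne_zero hsin hrabi.ne')) (Real.sqrt_pos.2 hn').ne'

/-- By unitarity, `|C(n)|² + (S(n)√n)² = 1`: having modulus one is the same as a vanishing
transition amplitude between `n-1` and `n`. -/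
lemma norm_C_eq_one {n : ℕ} (h : n ∈ {0} ∪ p.resonances) : ‖p.C n‖ = 1 := by
  have h1 := p.norm_C_sq_add n
  rw [p.S_mul_sqrt_eq_zero h] at h1
  exact (pow_eq_one_iff_of_nonneg (norm_nonneg _) two_ne_zero).1 (by linarith)

lemma norm_C_lt_one {n : ℕ} (h : n ∉ {0} ∪ p.resonances) : ‖p.C n‖ < 1 := by
  have h1 := p.norm_C_sq_add n
  have h2 := pow_pos (abs_pos.2 (p.S_mul_sqrt_ne_zero h)) 2
  rw [sq_abs] at h2
  exact (sq_lt_one_iff₀ (norm_nonneg _)).1 (by linarith)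

lemma norm_amp_of_mem {n : ℕ} (h : n ∈ p.oneDimSectors) (b : Bool) : ‖p.amp b n‖ = 1 := by
  cases b
  · rw [norm_amp_false]; exact p.norm_C_eq_one h.1
  · rw [norm_amp_true]; exact p.norm_C_eq_one (Or.inr h.2)

/-- If the lower edge of `{n}` is open, an atom entering in its ground state can absorb a photon; if
the upper edge is open, an excited atom can emit one. The corresponding amplitude for staying is
then strictly contracting. -/
lemma exists_norm_amp_lt {n : ℕ} (h : n ∉ p.oneDimSectors) : ∃ b, ‖p.amp b n‖ < 1 := by
  by_cases h1 : n ∈ {0} ∪ p.resonances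
  · refine ⟨true, ?_⟩
    rw [norm_amp_true]
    refine p.norm_C_lt_one fun h2 => h ⟨h1, ?_⟩
    rcases h2 with h2 | h2
    · exact absurd h2 (Nat.succ_ne_zero n)
    · exact h2
  · refine ⟨false, ?_⟩
    rw [norm_amp_false]
    exact p.norm_C_lt_one h1

lemma kraus_jump_fock {n : ℕ} (h : n ∈ p.oneDimSectors) {y : Outcome} (hy : y.1 ≠ y.2) :
    p.kraus y (fock n) = 0 := by
  have hS := p.S_mul_sqrt_eq_zero h.1
  have hS' : p.S (n + 1) * √((n + 1 : ℕ) : ℝ) = 0 := p.S_mul_sqrt_eq_zero (Or.inr h.2)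
  obtain ⟨σ, σ'⟩ := y
  ext k
  rw [lp.coeFn_zero, Pi.zero_apply]
  cases σ <;> cases σ'
  · exact absurd rfl hy
  · rw [kraus_mp_apply, fock_apply]
    split_ifs with hk
    · subst hk
      rw [Nat.cast_add, Nat.cast_one] at hS
      rw [hS]
      simp
    · simp
  · cases k with
    | zero => exact p.kraus_pm_apply_zero _
    | succ k =>
      rw [kraus_pm_apply_succ, fock_apply]
      split_ifs with hk
      · rw [hk, hS']
        simp
      · simp
  · exact absurd rfl hy

lemma exists_kraus_fock {n : ℕ} (h : n ∈ p.oneDimSectors) (y : Outcome) :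
    ∃ c : ℂ, p.kraus y (fock n) = c • fock n := by
  by_cases hy : y.1 = y.2
  · refine ⟨√(p.prob y.1) * p.amp y.1 n, ?_⟩
    rw [show y = (y.1, y.1) from Prod.ext rfl hy.symm, kraus_diag]
    change (√(p.prob y.1) : ℂ) • funN (p.amp y.1) (fock n) = _
    rw [funN_fock (p.norm_amp_le _), smul_smul]
  · exact ⟨0, by rw [p.kraus_jump_fock h hy, zero_smul]⟩

lemma exists_W_fock {n : ℕ} (h : n ∈ p.oneDimSectors) (ω : Outcomes) (t : ℕ) :
    ∃ c : ℂ, p.W ω t (fock n) = c • fock n := by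
  induction t with
  | zero => exact ⟨1, by rw [one_smul]; rfl⟩
  | succ t ih =>
    obtain ⟨c, hc⟩ := ih
    obtain ⟨c', hc'⟩ := p.exists_kraus_fock h (ω t)
    exact ⟨c * c', by rw [W, mul_op_apply, hc, map_smul, hc', smul_smul]⟩

/-- Every Kraus operator preserves the line spanned by `|n⟩` and a jump annihilates it, so a single
jump has a permanent effect. -/
lemma W_fock_eq_zero {n : ℕ} (h : n ∈ p.oneDimSectors) {ω : Outcomes} {i : ℕ}
    (hi : (ω i).1 ≠ (ω i).2) {t : ℕ} (ht : i < t) : p.W ω t (fock n) = 0 := by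
  induction t, ht using Nat.le_induction with
  | base =>
    obtain ⟨c, hc⟩ := p.exists_W_fock h ω i
    rw [W, mul_op_apply, hc, map_smul, p.kraus_jump_fock h hi, smul_zero]
  | succ t _ ih => rw [W, mul_op_apply, ih, map_zero]

/-! ### Outcomes without jumps -/

/-- The state of no atom changes. -/
def Jumpless (ω : Outcomes) : Prop := ∀ i, (ω i).1 = (ω i).2

/-- The product of the amplitudes along a sequence of outcomes without jumps. -/
def ampProd (ω : Outcomes) (t n : ℕ) : ℂ := ∏ i ∈ Finset.range t, p.amp (ω i).1 n

/-- The probability of the states in which the first `t` atoms enter. -/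
def probProd (ω : Outcomes) (t : ℕ) : ℝ := ∏ i ∈ Finset.range t, p.prob (ω i).1

lemma norm_ampProd_le (ω : Outcomes) (t n : ℕ) : ‖p.ampProd ω t n‖ ≤ 1 := by
  rw [ampProd, norm_prod]
  exact Finset.prod_le_one (fun _ _ => norm_nonneg _) fun _ _ => p.norm_amp_le _ _

lemma norm_ampProd_of_mem {n : ℕ} (h : n ∈ p.oneDimSectors) (ω : Outcomes) (t : ℕ) :
    ‖p.ampProd ω t n‖ = 1 := by
  rw [ampProd, norm_prod]
  exact Finset.prod_eq_one fun _ _ => p.norm_amp_of_mem h _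

lemma probProd_pos (ω : Outcomes) (t : ℕ) : 0 < p.probProd ω t :=
  Finset.prod_pos fun _ _ => p.prob_pos _

lemma W_eq {ω : Outcomes} {t : ℕ} (h : ∀ i < t, (ω i).1 = (ω i).2) :
    p.W ω t = (√(p.probProd ω t) : ℂ) • funN (p.ampProd ω t) := by
  induction t with
  | zero =>
    ext x n
    rw [smul_op_apply, funN_apply (p.norm_ampProd_le ω 0)]
    simp [W, probProd, ampProd]
  | succ t ih =>
    ext x n
    rw [W, ih fun i hi => h i (by omega), smul_op_apply, funN_apply (p.norm_ampProd_le ω _),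
      show ω t = ((ω t).1, (ω t).1) from Prod.ext rfl (h t t.lt_succ_self).symm, kraus_diag,
      mul_op_apply, smul_op_apply, funN_apply (p.norm_amp_le _), smul_op_apply,
      funN_apply (p.norm_ampProd_le ω _)]
    have hp : (√(p.probProd ω (t + 1)) : ℂ) = √(p.probProd ω t) * √(p.prob (ω t).1) := by
      rw [← Complex.ofReal_mul, ← Real.sqrt_mul (p.probProd_pos ω t).le, probProd, probProd,
        Finset.prod_range_succ]
    have ha : p.ampProd ω (t + 1) n = p.ampProd ω t n * p.amp (ω t).1 n := by
      rw [ampProd, ampProd, Finset.prod_range_succ]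
    rw [hp, ha]
    ring

lemma norm_sqrt_probProd_sq (ω : Outcomes) (t : ℕ) :
    ‖(√(p.probProd ω t) : ℂ)‖ ^ 2 = p.probProd ω t := by
  rw [Complex.norm_real, Real.norm_of_nonneg (Real.sqrt_nonneg _),
    Real.sq_sqrt (p.probProd_pos ω t).le]

lemma evolved_eq {ω : Outcomes} {t : ℕ} (h : ∀ i < t, (ω i).1 = (ω i).2) (A : Op) :
    p.evolved A ω t = (p.probProd ω t : ℂ) • (funN (p.ampProd ω t) * A
      * ContinuousLinearMap.adjoint (funN (p.ampProd ω t))) := by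
  rw [evolved, p.W_eq h, smul_conj_smul, norm_sqrt_probProd_sq]

lemma trace_evolved_eq {ω : Outcomes} {t : ℕ} (h : ∀ i < t, (ω i).1 = (ω i).2)
    (ρ : DensityOperator) :
    trace (p.evolved ρ.op ω t) = (p.probProd ω t * ρ.meanSq (p.ampProd ω t) : ℝ) := by
  rw [p.evolved_eq h, trace_smul, ρ.trace_conj (p.norm_ampProd_le ω t), Complex.ofReal_mul]

/-- No jumps, and both states of the atoms occur infinitely often. -/
def goodOutcomes : Set Outcomes :=
  {ω | Jumpless ω ∧ ∀ b, ∃ᶠ i in atTop, (ω i).1 = b}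

/-- Which atomic state contracts depends on `n`; this is why both states are required to recur. -/
lemma tendsto_ampProd {ω : Outcomes} (hω : ω ∈ goodOutcomes) {n : ℕ} (h : n ∉ p.oneDimSectors) :
    Tendsto (fun t => ‖p.ampProd ω t n‖) atTop (𝓝 0) := by
  obtain ⟨b, hb⟩ := p.exists_norm_amp_lt h
  simp only [ampProd, norm_prod]
  exact tendsto_prod_zero (fun _ => norm_nonneg _) (fun _ => p.norm_amp_le _ _) hb
    ((hω.2 b).mono fun i hi => by rw [hi])

lemma Q_eq_proj : p.Q = proj p.oneDimSectors := rfl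

lemma oneDimSectors_nonempty (hdeg : p.IsDegenerate) : p.oneDimSectors.Nonempty := by
  obtain ⟨m, n, hm, -, -, hm', -⟩ := hdeg
  exact ⟨m, hm, hm'⟩

/-! ### The invariant state and the event `O` -/

/-- The Boltzmann factors. -/
def boltzmann (n : ℕ) : ℝ := Real.exp (-p.β * p.ε * n)

lemma gibbs_eq : p.gibbs = funN fun n => (p.boltzmann n : ℂ) := by
  unfold gibbs boltzmann
  push_cast
  rfl

variable {p} in
lemma norm_boltzmann_le (hβ : 0 < p.β) (n : ℕ) : ‖(p.boltzmann n : ℂ)‖ ≤ 1 := by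
  rw [Complex.norm_real, boltzmann, Real.norm_of_nonneg (Real.exp_pos _).le, Real.exp_le_one_iff]
  have := mul_nonneg (mul_pos hβ p.ε_pos).le (Nat.cast_nonneg (α := ℝ) n)
  linarith

variable {p} in
lemma summable_boltzmann (hβ : 0 < p.β) : Summable p.boltzmann := by
  have h : p.boltzmann = fun n => Real.exp (-p.β * p.ε) ^ n := by
    ext n
    rw [boltzmann, mul_comm, Real.exp_nat_mul]
  rw [h]
  refine summable_geometric_of_lt_one (Real.exp_pos _).le (Real.exp_lt_one_iff.2 ?_)
  have := mul_pos hβ p.ε_pos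
  linarith

/-- The partition function. -/
def partition : ℝ := ∑' n, p.boltzmann n

variable {p} in
lemma partition_pos (hβ : 0 < p.β) : 0 < p.partition :=
  (summable_boltzmann hβ).tsum_pos (fun _ => (Real.exp_pos _).le) 0 (Real.exp_pos _)

/-- The populations of the invariant state. -/
def gibbsPop (n : ℕ) : ℝ := p.partition⁻¹ * p.boltzmann n

variable {p} in
lemma gibbsPop_pos (hβ : 0 < p.β) (n : ℕ) : 0 < p.gibbsPop n :=
  mul_pos (inv_pos.2 (partition_pos hβ)) (Real.exp_pos _)

variable {p} in
lemma norm_gibbsPop_le (hβ : 0 < p.β) (n : ℕ) : ‖(p.gibbsPop n : ℂ)‖ ≤ p.partition⁻¹ := by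
  rw [gibbsPop, Complex.ofReal_mul, norm_mul, Complex.norm_real,
    Real.norm_of_nonneg (inv_pos.2 (partition_pos hβ)).le]
  exact mul_le_of_le_one_right (inv_pos.2 (partition_pos hβ)).le (norm_boltzmann_le hβ n)

variable {p} in
lemma rhoInv_eq (hβ : 0 < p.β) : p.rhoInv = funN fun n => (p.gibbsPop n : ℂ) := by
  have h : trace p.gibbs = p.partition := by
    rw [gibbs_eq, trace, partition, Complex.ofReal_tsum]
    congr 1 with n
    rw [entry_funN (norm_boltzmann_le hβ)]
  rw [rhoInv, h, gibbs_eq, smul_funN _ (norm_boltzmann_le hβ)]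
  simp only [gibbsPop, Complex.ofReal_mul, Complex.ofReal_inv]

variable {p} in
/-- The Gibbs state as a density operator. -/
def invState (hβ : 0 < p.β) : DensityOperator where
  op := p.rhoInv
  isPositive := by
    rw [rhoInv_eq hβ]
    exact isPositive_funN (norm_gibbsPop_le hβ) fun n => ⟨_, (gibbsPop_pos hβ n).le, rfl⟩
  hasSum_entry := by
    simp only [rhoInv_eq hβ, entry_funN (norm_gibbsPop_le hβ)]
    have h := ((summable_boltzmann hβ).hasSum.mul_left p.partition⁻¹)
    rw [← partition, inv_mul_cancel₀ (partition_pos hβ).ne'] at h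
    simpa [gibbsPop] using Complex.hasSum_ofReal.2 h

variable {p} in
lemma trace_rhoInv_mul_Q_ne_zero (hβ : 0 < p.β) (hN : p.oneDimSectors.Nonempty) :
    trace (p.rhoInv * p.Q) ≠ 0 := by
  classical
  obtain ⟨n, hn⟩ := hN
  have h := (invState hβ).trace_mul_proj p.oneDimSectors
  rw [← Q_eq_proj] at h
  change trace (p.rhoInv * p.Q) = _ at h
  rw [h, Complex.ofReal_ne_zero]
  refine (((invState hβ).summable_sq_mul_pop (DensityOperator.norm_ite_le _)).tsum_pos
    (fun n => mul_nonneg (by positivity) ((invState hβ).pop_nonneg n)) n ?_).ne'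
  have : 0 < (invState hβ).pop n := by
    change 0 < (entry p.rhoInv n n).re
    rw [rhoInv_eq hβ, entry_funN (norm_gibbsPop_le hβ), Complex.ofReal_re]
    exact gibbsPop_pos hβ n
  simpa [hn] using this

lemma MInf_eq {ω : Outcomes} {L : Op} (h : TendstoTraceNorm (p.M ω) L) : p.MInf ω = L := by
  have h' : ∃ L, TendstoTraceNorm (p.M ω) L := ⟨L, h⟩
  rw [MInf, dif_pos h']
  exact tendsto_nhds_unique h'.choose_spec.tendsto h.tendsto

variable {p} in
lemma sqrtOp_rhoInv (hβ : 0 < p.β) : sqrtOp p.rhoInv = funN (fun n => (√(p.gibbsPop n) : ℂ)) ∧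
    ∀ n, ‖(√(p.gibbsPop n) : ℂ)‖ ≤ √p.partition⁻¹ := by
  have hb : ∀ n, ‖(√(p.gibbsPop n) : ℂ)‖ ≤ √p.partition⁻¹ := fun n => by
    rw [Complex.norm_real, Real.norm_of_nonneg (Real.sqrt_nonneg _)]
    refine Real.sqrt_le_sqrt ((le_of_eq ?_).trans (norm_gibbsPop_le hβ n))
    rw [Complex.norm_real, Real.norm_of_nonneg (gibbsPop_pos hβ n).le]
  refine ⟨sqrtOp_eq (isPositive_funN hb fun n => ⟨_, Real.sqrt_nonneg _, rfl⟩) ?_, hb⟩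
  rw [funN_mul_funN hb hb, rhoInv_eq hβ]
  congr 1 with n
  rw [← Complex.ofReal_mul, Real.mul_self_sqrt (gibbsPop_pos hβ n).le]

variable {p} in
-- All factors commute, so only `|d_t|²` survives in `W_t* W_t` and the probability factor cancels.
-- This is the form of `M_t` to which `tendsto_traceNorm_conj` applies.
lemma M_eq (hβ : 0 < p.β) {ω : Outcomes} (hω : Jumpless ω) (t : ℕ) :
    p.M ω t = (trace (funN (fun n => (‖p.ampProd ω t n‖ : ℂ)) * p.rhoInv *
        ContinuousLinearMap.adjoint (funN fun n => (‖p.ampProd ω t n‖ : ℂ))))⁻¹ •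
      (funN (fun n => (‖p.ampProd ω t n‖ : ℂ)) * p.rhoInv *
        ContinuousLinearMap.adjoint (funN fun n => (‖p.ampProd ω t n‖ : ℂ))) := by
  obtain ⟨hs, hsb⟩ := sqrtOp_rhoInv hβ
  have hd := p.norm_ampProd_le ω t
  have hd' : ∀ n, ‖(‖p.ampProd ω t n‖ : ℂ)‖ ≤ 1 := fun n => by simpa using hd n
  have hW : ContinuousLinearMap.adjoint (p.W ω t) * p.W ω t
      = (p.probProd ω t : ℂ) • funN fun n => (starRingEnd ℂ) (p.ampProd ω t n) * p.ampProd ω t n := by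
    rw [p.W_eq fun i _ => hω i, map_smulₛₗ, smul_mul_assoc, mul_smul_comm, smul_smul,
      adjoint_funN hd, funN_mul_funN (norm_conj_le hd) hd, mul_comm, Complex.mul_conj,
      Complex.normSq_eq_norm_sq, norm_sqrt_probProd_sq]
  have hg := norm_gibbsPop_le hβ
  have hdd := norm_mul_le_mul (norm_conj_le hd) hd
  set D : Op := funN fun n => (‖p.ampProd ω t n‖ : ℂ) with hD
  have h1 : D * p.rhoInv * ContinuousLinearMap.adjoint D = funN fun n =>
      (starRingEnd ℂ) (p.ampProd ω t n) * p.ampProd ω t n * p.gibbsPop n := by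
    rw [hD, adjoint_funN hd', rhoInv_eq hβ, funN_mul_funN hd' hg,
      funN_mul_funN (norm_mul_le_mul hd' hg) (norm_conj_le hd')]
    congr 1 with n
    rw [Complex.conj_ofReal, mul_comm ((starRingEnd ℂ) _), Complex.mul_conj,
      Complex.normSq_eq_norm_sq]
    push_cast
    ring
  have h2 : ContinuousLinearMap.adjoint (p.W ω t) * p.W ω t * p.rhoInv
      = (p.probProd ω t : ℂ) • (D * p.rhoInv * ContinuousLinearMap.adjoint D) := by
    rw [h1, hW, smul_mul_assoc, rhoInv_eq hβ, funN_mul_funN hdd hg]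
  have h3 : sqrtOp p.rhoInv * ContinuousLinearMap.adjoint (p.W ω t) * p.W ω t * sqrtOp p.rhoInv
      = (p.probProd ω t : ℂ) • (D * p.rhoInv * ContinuousLinearMap.adjoint D) := by
    rw [mul_assoc (sqrtOp p.rhoInv) (ContinuousLinearMap.adjoint (p.W ω t)) (p.W ω t), hW, h1, hs,
      mul_smul_comm, smul_mul_assoc, funN_mul_funN hsb hdd,
      funN_mul_funN (norm_mul_le_mul hsb hdd) hsb]
    congr 2 with n
    have : (p.gibbsPop n : ℂ) = √(p.gibbsPop n) * √(p.gibbsPop n) := by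
      rw [← Complex.ofReal_mul, Real.mul_self_sqrt (gibbsPop_pos hβ n).le]
    rw [this]
    ring
  rw [M, h2, h3, normalize_smul (Complex.ofReal_ne_zero.2 (p.probProd_pos ω t).ne')]

variable {p} in
lemma goodOutcomes_subset_eventO (hβ : 0 < p.β) (hN : p.oneDimSectors.Nonempty) :
    goodOutcomes ⊆ p.eventO := by
  classical
  intro ω hω
  refine p.MInf_eq ?_
  have hd : ∀ t n, ‖(‖p.ampProd ω t n‖ : ℂ)‖ ≤ 1 := fun t n => by
    simpa using p.norm_ampProd_le ω t n
  have h := (invState hβ).tendsto_traceNorm_conj (N := p.oneDimSectors)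
    (d := fun t n => (‖p.ampProd ω t n‖ : ℂ)) hd
    (fun n hn t => by simpa using p.norm_ampProd_of_mem hn ω t)
    (fun n hn => by simpa using p.tendsto_ampProd hω hn) (trace_rhoInv_mul_Q_ne_zero hβ hN)
  refine h.congr fun t => ?_
  congr 1
  rw [M_eq hβ hω.1 t]
  congr 1
  -- The moduli equal one on the sectors, so this conjugation leaves the compressed Gibbs state
  -- unchanged.
  change _ * ((trace (p.rhoInv * p.Q))⁻¹ • (p.Q * p.rhoInv * p.Q)) * _ = _
  have hq := DensityOperator.norm_ite_le p.oneDimSectors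
  refine op_ext fun n m => ?_
  rw [adjoint_funN (hd t), entry_mul_funN (norm_conj_le (hd t)), entry_funN_mul (hd t), entry_smul,
    Q_eq_proj, proj_eq, entry_mul_funN hq, entry_funN_mul hq]
  by_cases hn : n ∈ p.oneDimSectors
  · by_cases hm : m ∈ p.oneDimSectors
    · simp [p.norm_ampProd_of_mem hn, p.norm_ampProd_of_mem hm]
    · simp [hm]
  · simp [hn]

variable {p} in
lemma jumpless_of_mem_eventO (hβ : 0 < p.β) (hN : p.oneDimSectors.Nonempty) {ω : Outcomes}
    (hω : ω ∈ p.eventO) : Jumpless ω := by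
  classical
  by_contra hj
  unfold Jumpless at hj
  push Not at hj
  obtain ⟨i, hi⟩ := hj
  have htr := trace_rhoInv_mul_Q_ne_zero hβ hN
  obtain ⟨n, hn⟩ := hN
  -- Both branches of the definition agree here: a limit inherits `M_t|n⟩ = 0` from all `t > i`, and
  -- the default value is zero. The state in the definition of `O` has a positive entry at `n`
  -- instead.
  have hM : p.MInf ω (fock n) = 0 := by
    unfold MInf
    split_ifs with h
    · have h1 := ((ContinuousLinearMap.apply ℂ FockSpace (fock n)).continuous.tendsto _).comp
        h.choose_spec.tendsto
      refine tendsto_nhds_unique h1 (tendsto_const_nhds.congr' ?_)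
      filter_upwards [eventually_gt_atTop i] with t ht
      obtain ⟨hs, hsb⟩ := sqrtOp_rhoInv hβ
      change 0 = p.M ω t (fock n)
      rw [M]
      change 0 = (_ : ℂ) • (sqrtOp p.rhoInv (ContinuousLinearMap.adjoint (p.W ω t)
        (p.W ω t (sqrtOp p.rhoInv (fock n)))))
      rw [hs, funN_fock hsb, map_smul, p.W_fock_eq_zero hn hi ht]
      simp
    · rfl
  have hq := DensityOperator.norm_ite_le p.oneDimSectors
  have he : entry (p.MInf ω) n n = (trace (p.rhoInv * p.Q))⁻¹ * p.gibbsPop n := by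
    rw [show p.MInf ω = _ from hω, entry_smul, Q_eq_proj, proj_eq, entry_mul_funN hq,
      entry_funN_mul hq, rhoInv_eq hβ, entry_funN (norm_gibbsPop_le hβ)]
    simp [hn]
  rw [entry, hM, inner_zero_right] at he
  exact mul_ne_zero (inv_ne_zero htr) (Complex.ofReal_ne_zero.2 (gibbsPop_pos hβ n).ne') he.symm

end Params

end Maser

end
noncomputable section

namespace Maser

namespace Params

variable (p : Params)

/-! ### The probability of the event `O` -/

lemma measurableSet_coord (i : ℕ) (P : Outcome → Prop) :
    MeasurableSet {ω : Outcomes | P (ω i)} :=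
  (Set.toFinite {y : Outcome | P y}).measurableSet.preimage
    (measurable_pi_apply (X := fun _ : ℕ => Outcome) i)

lemma measurableSet_cylinder (t : ℕ) (y : Outcomes) :
    MeasurableSet {ω : Outcomes | ∀ i < t, ω i = y i} := by
  simp only [Set.ofPred_forall]
  exact MeasurableSet.iInter fun i => MeasurableSet.iInter fun _ =>
    measurableSet_coord i fun z => z = y i

lemma measurableSet_jumpless_upto (t : ℕ) :
    MeasurableSet {ω : Outcomes | ∀ i < t, (ω i).1 = (ω i).2} := by
  simp only [Set.ofPred_forall]
  exact MeasurableSet.iInter fun i => MeasurableSet.iInter fun _ =>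
    measurableSet_coord i fun z => z.1 = z.2

lemma measurableSet_goodOutcomes : MeasurableSet goodOutcomes := by
  have h : goodOutcomes = (⋂ i, {ω : Outcomes | (ω i).1 = (ω i).2}) ∩
      ⋂ b, ⋂ m : ℕ, ⋃ i : ℕ, ⋃ _ : m ≤ i, {ω : Outcomes | (ω i).1 = b} := by
    ext ω
    simp [goodOutcomes, Jumpless, frequently_atTop]
  rw [h]
  refine (MeasurableSet.iInter fun i => ?_).inter (MeasurableSet.iInter fun b =>
    MeasurableSet.iInter fun m => MeasurableSet.iUnion fun i => MeasurableSet.iUnion fun _ => ?_)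
  · exact measurableSet_coord i fun z => z.1 = z.2
  · exact measurableSet_coord i fun z => z.1 = b

lemma countable_eventually_const (y : Outcome) :
    {ω : Outcomes | ∃ m, ∀ i ≥ m, ω i = y}.Countable := by
  rw [Set.ofPred_exists]
  refine Set.countable_iUnion fun m => Set.Finite.countable ?_
  refine Set.Finite.of_injOn (f := fun ω : Outcomes => fun i : Fin m => ω i)
    (t := Set.univ) (fun _ _ => Set.mem_univ _) (fun ω hω ω' hω' h => ?_) Set.finite_univ
  ext1 i
  by_cases hi : i < m
  · exact congrFun h ⟨i, hi⟩
  · rw [hω i (not_lt.1 hi), hω' i (not_lt.1 hi)]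

/-- If one atomic state occurs only finitely often, the other one is eventually permanent, and
without jumps this fixes the whole outcome from some time on. -/
lemma countable_jumpless_diff : ({ω : Outcomes | Jumpless ω} \ goodOutcomes).Countable := by
  refine ((countable_eventually_const (false, false)).union
    (countable_eventually_const (true, true))).mono fun ω hω => ?_
  obtain ⟨hj, hg⟩ := hω
  have hb : ∃ b, ¬ ∃ᶠ i in atTop, (ω i).1 = b := by
    by_contra h
    push Not at h
    exact hg ⟨hj, h⟩
  obtain ⟨b, hb⟩ := hb
  rw [not_frequently, eventually_atTop] at hb
  obtain ⟨m, hm⟩ := hb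
  have h : ∀ i ≥ m, ω i = (!b, !b) := fun i hi => by
    have h1 : (ω i).1 = !b := by
      rw [Bool.eq_not]
      exact hm i hi
    exact Prod.ext h1 ((hj i).symm.trans h1)
  cases b
  · exact Or.inr ⟨m, h⟩
  · exact Or.inl ⟨m, h⟩

lemma probProd_le (ω : Outcomes) (t : ℕ) :
    p.probProd ω t ≤ max (p.prob false) (p.prob true) ^ t := by
  rw [probProd, ← Finset.card_range t, ← Finset.prod_const, Finset.card_range]
  refine Finset.prod_le_prod (fun _ _ => (p.prob_pos _).le) fun i _ => ?_
  cases (ω i).1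
  exacts [le_max_left _ _, le_max_right _ _]

/-- The cylinder of length `t` around a jumpless sequence has probability at most `max(p₋, p₊)^t`,
because both states of the incoming atoms have probability less than one. -/
lemma outcomeMeasure_singleton (ρ : DensityOperator) {ω : Outcomes} (hω : Jumpless ω) :
    p.outcomeMeasure ρ {ω} = 0 := by
  have h : ∀ t, p.outcomeMeasure ρ {ω}
      ≤ ENNReal.ofReal (max (p.prob false) (p.prob true) ^ t) := fun t => by
    refine (measure_mono (t := {ω' | ∀ i < t, ω' i = ω i}) ?_).trans ?_
    · rintro _ rfl i _
      rfl
    · rw [outcomeMeasure_cylinder, p.trace_evolved_eq fun i _ => hω i, Complex.ofReal_re]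
      refine ENNReal.ofReal_le_ofReal ((mul_le_of_le_one_right (p.probProd_pos ω t).le
        (ρ.meanSq_le_one (p.norm_ampProd_le ω t))).trans (p.probProd_le ω t))
  have h1 : Tendsto (fun t : ℕ => ENNReal.ofReal (max (p.prob false) (p.prob true) ^ t)) atTop
      (𝓝 0) := by
    rw [← ENNReal.ofReal_zero]
    exact ENNReal.tendsto_ofReal (tendsto_pow_atTop_nhds_zero_of_lt_one
      ((p.prob_pos false).le.trans (le_max_left _ _)) (max_lt (p.prob_lt_one _) (p.prob_lt_one _)))
  exact le_antisymm (ge_of_tendsto' h1 h) zero_le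

lemma outcomeMeasure_jumpless_diff (ρ : DensityOperator) :
    p.outcomeMeasure ρ ({ω : Outcomes | Jumpless ω} \ goodOutcomes) = 0 := by
  rw [← Set.biUnion_of_singleton ({ω : Outcomes | Jumpless ω} \ goodOutcomes),
    measure_biUnion_null_iff countable_jumpless_diff]
  exact fun ω hω => p.outcomeMeasure_singleton ρ hω.1

/-- The probability of no jump from `|n⟩`. -/
def stay (n : ℕ) : ℝ := ∑ b, p.prob b * ‖p.amp b n‖ ^ 2

lemma stay_nonneg (n : ℕ) : 0 ≤ p.stay n :=
  Finset.sum_nonneg fun b _ => mul_nonneg (p.prob_pos b).le (sq_nonneg _)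

lemma stay_le_one (n : ℕ) : p.stay n ≤ 1 := by
  rw [stay, ← p.sum_prob]
  exact Finset.sum_le_sum fun b _ => mul_le_of_le_one_right (p.prob_pos b).le
    (pow_le_one₀ (norm_nonneg _) (p.norm_amp_le b n))

lemma stay_of_mem {n : ℕ} (h : n ∈ p.oneDimSectors) : p.stay n = 1 := by
  rw [stay, ← p.sum_prob]
  exact Finset.sum_congr rfl fun b _ => by rw [p.norm_amp_of_mem h, one_pow, mul_one]

lemma stay_lt_one {n : ℕ} (h : n ∉ p.oneDimSectors) : p.stay n < 1 := by
  obtain ⟨b, hb⟩ := p.exists_norm_amp_lt h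
  rw [stay, ← p.sum_prob]
  exact Finset.sum_lt_sum (fun b _ => mul_le_of_le_one_right (p.prob_pos b).le
    (pow_le_one₀ (norm_nonneg _) (p.norm_amp_le b n))) ⟨b, Finset.mem_univ b,
    mul_lt_of_lt_one_right (p.prob_pos b) (pow_lt_one₀ (norm_nonneg _) hb two_ne_zero)⟩

/-- The sequence of outcomes without jumps that starts with the given states. -/
def diagOutcomes {t : ℕ} (y : Fin t → Bool) : Outcomes :=
  fun i => if h : i < t then (y ⟨i, h⟩, y ⟨i, h⟩) else (false, false)

lemma diagOutcomes_apply {t : ℕ} (y : Fin t → Bool) (i : Fin t) :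
    diagOutcomes y i = (y i, y i) := by
  simp [diagOutcomes]

lemma jumpless_diagOutcomes {t : ℕ} (y : Fin t → Bool) : Jumpless (diagOutcomes y) := fun i => by
  unfold diagOutcomes
  split_ifs <;> rfl

/-- Without jumps `n` is conserved. Summing over the `2^t` words of incoming states, at fixed `n`, a
product of one-step probabilities gives the `t`-th power of the one-step sum. -/
lemma outcomeMeasure_jumpless_upto (ρ : DensityOperator) (t : ℕ) :
    p.outcomeMeasure ρ {ω | ∀ i < t, (ω i).1 = (ω i).2}
      = ENNReal.ofReal (∑' n, p.stay n ^ t * ρ.pop n) := by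
  have h : {ω : Outcomes | ∀ i < t, (ω i).1 = (ω i).2}
      = ⋃ y : Fin t → Bool, {ω | ∀ i < t, ω i = diagOutcomes y i} := by
    ext ω
    simp only [Set.mem_iUnion]
    constructor
    · intro hω
      refine ⟨fun i => (ω i).1, fun i hi => ?_⟩
      rw [diagOutcomes_apply _ ⟨i, hi⟩]
      exact Prod.ext rfl (hω i hi).symm
    · rintro ⟨y, hy⟩ i hi
      rw [hy i hi]
      exact jumpless_diagOutcomes y i
  have hdisj : Pairwise (Function.onFun Disjoint
      fun y : Fin t → Bool => {ω : Outcomes | ∀ i < t, ω i = diagOutcomes y i}) := by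
    intro y y' hne
    refine Set.disjoint_left.2 fun ω hω hω' => hne ?_
    ext1 i
    have h1 := (hω i i.2).symm.trans (hω' i i.2)
    rw [diagOutcomes_apply, diagOutcomes_apply] at h1
    exact congrArg Prod.fst h1
  have hterm : ∀ y : Fin t → Bool, ∀ n, p.probProd (diagOutcomes y) t
        * (‖p.ampProd (diagOutcomes y) t n‖ ^ 2 * ρ.pop n)
      = (∏ i, p.prob (y i) * ‖p.amp (y i) n‖ ^ 2) * ρ.pop n := fun y n => by
    rw [← mul_assoc, probProd, ampProd, norm_prod, ← Finset.prod_pow, ← Finset.prod_mul_distrib,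
      Finset.prod_range]
    simp only [diagOutcomes_apply]
  rw [h, measure_iUnion hdisj fun y => measurableSet_cylinder t _, tsum_fintype]
  simp only [outcomeMeasure_cylinder, p.trace_evolved_eq fun i _ => jumpless_diagOutcomes _ i,
    Complex.ofReal_re]
  rw [← ENNReal.ofReal_sum_of_nonneg fun y _ =>
    mul_nonneg (p.probProd_pos _ t).le (ρ.meanSq_nonneg _)]
  congr 1
  simp only [DensityOperator.meanSq, ← tsum_mul_left]
  rw [← Summable.tsum_finsetSum fun y _ =>
    (ρ.summable_sq_mul_pop (p.norm_ampProd_le (diagOutcomes y) t)).mul_left _]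
  congr 1 with n
  simp only [hterm]
  rw [← Finset.sum_mul, stay, Fintype.sum_pow]

/-- Continuity from above in `t`, together with the dominated convergence of `stay n ^ t` to the
indicator of the one-dimensional sectors. -/
lemma outcomeMeasure_jumpless (ρ : DensityOperator) :
    ((p.outcomeMeasure ρ).real {ω | Jumpless ω} : ℂ) = trace (ρ.op * p.Q) := by
  classical
  have hset : {ω : Outcomes | Jumpless ω} = ⋂ t : ℕ, {ω | ∀ i < t, (ω i).1 = (ω i).2} := by
    ext ω
    simp only [Set.mem_iInter]
    exact ⟨fun h t i _ => h i, fun h i => h (i + 1) i i.lt_succ_self⟩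
  have h1 : Tendsto (fun t : ℕ => p.outcomeMeasure ρ {ω | ∀ i < t, (ω i).1 = (ω i).2}) atTop
      (𝓝 (p.outcomeMeasure ρ {ω | Jumpless ω})) := by
    rw [hset]
    exact tendsto_measure_iInter_atTop
      (fun t => (measurableSet_jumpless_upto t).nullMeasurableSet)
      (fun t t' htt' ω hω i hi => hω i (hi.trans_le htt')) ⟨0, measure_ne_top _ _⟩
  have h2 : Tendsto (fun t : ℕ => ∑' n, p.stay n ^ t * ρ.pop n) atTop
      (𝓝 (ρ.meanSq fun n => if n ∈ p.oneDimSectors then 1 else 0)) := by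
    refine tendsto_tsum_of_dominated_convergence ρ.hasSum_pop.summable (fun n => ?_)
      (Eventually.of_forall fun t n => ?_)
    · refine Tendsto.mul_const _ ?_
      by_cases h : n ∈ p.oneDimSectors
      · have h3 : Tendsto (fun t : ℕ => p.stay n ^ t) atTop (𝓝 1) :=
          tendsto_const_nhds.congr fun t => by rw [p.stay_of_mem h, one_pow]
        simpa [h] using h3
      · simpa [h] using tendsto_pow_atTop_nhds_zero_of_lt_one (p.stay_nonneg n) (p.stay_lt_one h)
    · rw [Real.norm_of_nonneg (mul_nonneg (pow_nonneg (p.stay_nonneg n) t) (ρ.pop_nonneg n))]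
      exact mul_le_of_le_one_left (ρ.pop_nonneg n) (pow_le_one₀ (p.stay_nonneg n) (p.stay_le_one n))
  simp only [outcomeMeasure_jumpless_upto] at h1
  have h3 := tendsto_nhds_unique h1 (ENNReal.tendsto_ofReal h2)
  rw [measureReal_def, h3, ENNReal.toReal_ofReal (ρ.meanSq_nonneg _), Q_eq_proj, ρ.trace_mul_proj]

/-! ### Asymptotics of the quantum trajectory -/

/-- `C(n) = cos(πk) = (-1)^k`, and `k²` has the parity of `k`. This trades the square root in the
Rabi frequency for a phase affine in `n`; being real, `C(n)` and its conjugate share it. -/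
lemma C_eq_exp {n k : ℕ} (h : p.ξ * n + p.η = (k : ℝ) ^ 2) :
    p.C n = Complex.exp (-Complex.I * (Real.pi * (p.ξ * n + p.η) : ℝ)) ∧
      (starRingEnd ℂ) (p.C n) = Complex.exp (-Complex.I * (Real.pi * (p.ξ * n + p.η) : ℝ)) := by
  have hr : p.rabi n = k := by rw [rabi, h, Real.sqrt_sq (Nat.cast_nonneg k)]
  have hC : p.C n = ((-1 : ℝ) ^ k : ℝ) := by
    rw [C, hr, mul_comm Real.pi, Real.sin_nat_mul_pi, Real.cos_nat_mul_pi]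
    simp
  have he : Complex.exp (-Complex.I * (Real.pi * (p.ξ * n + p.η) : ℝ)) = ((-1 : ℝ) ^ k : ℝ) := by
    have h1 : -Complex.I * (Real.pi * (p.ξ * n + p.η) : ℝ)
        = ((-(((k ^ 2 : ℕ) : ℝ) * Real.pi) : ℝ) : ℂ) * Complex.I := by
      rw [h]; push_cast; ring
    have h2 : (-1 : ℝ) ^ (k ^ 2) = (-1) ^ k := by
      rcases Nat.even_or_odd k with hk | hk
      · rw [hk.neg_one_pow, (hk.pow_of_ne_zero two_ne_zero).neg_one_pow]
      · rw [hk.neg_one_pow, hk.pow.neg_one_pow]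
    rw [h1, Complex.exp_mul_I, ← Complex.ofReal_cos, ← Complex.ofReal_sin, Real.cos_neg,
      Real.sin_neg, Real.sin_nat_mul_pi, Real.cos_nat_mul_pi, h2]
    simp
  rw [he, hC]
  exact ⟨rfl, Complex.conj_ofReal _⟩

/-- The part of the amplitudes that does not depend on the one-dimensional sector. -/
def commonPhase : Bool → ℂ
  | false => Complex.exp (-Complex.I * (Real.pi * p.η : ℝ))
  | true => Complex.exp (-Complex.I * (Real.pi * (p.ξ + p.η) : ℝ))

lemma norm_commonPhase (b : Bool) : ‖p.commonPhase b‖ = 1 := by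
  cases b <;> exact norm_exp_phase _

/-- Separates the affine phase into a part common to all sectors and a linear part. Membership of
`n` in the sectors supplies the square at `n+1`; the square at `n` is a separate hypothesis because
it may fail at `n = 0`. -/
lemma amp_eq {n k : ℕ} (hk : p.ξ * n + p.η = (k : ℝ) ^ 2) (hn : n ∈ p.oneDimSectors) (b : Bool) :
    p.amp b n = p.commonPhase b
      * Complex.exp (-Complex.I * ((p.ε * p.τ + Real.pi * p.ξ) * n : ℝ)) := by
  cases b
  · rw [amp, commonPhase, (p.C_eq_exp hk).1, ← Complex.exp_add, ← Complex.exp_add]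
    congr 1
    push_cast
    ring
  · obtain ⟨-, l, -, hl⟩ := hn.2
    rw [amp, commonPhase, (p.C_eq_exp hl).2, ← Complex.exp_add, ← Complex.exp_add]
    congr 1
    push_cast
    ring

lemma ampProd_eq {n k : ℕ} (hk : p.ξ * n + p.η = (k : ℝ) ^ 2) (hn : n ∈ p.oneDimSectors)
    (ω : Outcomes) (t : ℕ) :
    p.ampProd ω t n = (∏ i ∈ Finset.range t, p.commonPhase (ω i).1)
      * Complex.exp (-Complex.I * ((p.ε * p.τ + Real.pi * p.ξ) * n * t : ℝ)) := by
  rw [ampProd]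
  simp only [p.amp_eq hk hn]
  rw [Finset.prod_mul_distrib, Finset.prod_const, Finset.card_range, ← Complex.exp_nat_mul]
  congr 2
  push_cast
  ring

lemma conj_exp_phase (r : ℝ) : (starRingEnd ℂ) (Complex.exp (-Complex.I * (r : ℝ)))
    = Complex.exp (-Complex.I * (-r : ℝ)) := by
  rw [← Complex.exp_conj]
  congr 1
  simp

/-- The common phases depend on the outcomes but not on `n`, so they cancel against their
conjugates. On the diagonal, modulus one is already enough. -/
lemma ampProd_mul_conj {n m : ℕ} (hn : n ∈ p.oneDimSectors) (hm : m ∈ p.oneDimSectors)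
    (h : n = m ∨ ((∃ k : ℕ, p.ξ * n + p.η = (k : ℝ) ^ 2) ∧ ∃ k : ℕ, p.ξ * m + p.η = (k : ℝ) ^ 2))
    (ω : Outcomes) (t : ℕ) :
    p.ampProd ω t n * (starRingEnd ℂ) (p.ampProd ω t m)
      = Complex.exp (-Complex.I * ((p.ε * p.τ + Real.pi * p.ξ) * n * t : ℝ))
        * Complex.exp (-Complex.I * ((p.ε * p.τ + Real.pi * p.ξ) * m * -t : ℝ)) := by
  have hconj : Complex.exp (-Complex.I * ((p.ε * p.τ + Real.pi * p.ξ) * m * -t : ℝ))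
      = (starRingEnd ℂ) (Complex.exp (-Complex.I * ((p.ε * p.τ + Real.pi * p.ξ) * m * t : ℝ))) := by
    rw [conj_exp_phase, mul_neg]
  rw [hconj]
  rcases h with rfl | ⟨⟨k, hk⟩, l, hl⟩
  · rw [Complex.mul_conj, Complex.mul_conj, Complex.normSq_eq_norm_sq, Complex.normSq_eq_norm_sq,
      p.norm_ampProd_of_mem hn, norm_exp_phase]
  · rw [p.ampProd_eq hk hn, p.ampProd_eq hl hm, map_mul, mul_mul_mul_comm, Complex.mul_conj,
      Complex.normSq_eq_norm_sq, norm_prod, Finset.prod_eq_one fun i _ => p.norm_commonPhase _]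
    simp

lemma exists_sq_of_mem {n : ℕ} (hn : n ∈ p.oneDimSectors) (h0 : n ≠ 0) :
    ∃ k : ℕ, p.ξ * n + p.η = (k : ℝ) ^ 2 := by
  rcases hn.1 with h | ⟨-, k, -, hk⟩
  · exact absurd h h0
  · exact ⟨k, hk⟩

lemma trajectory_eq (ρ : DensityOperator) {ω : Outcomes} (hω : Jumpless ω) (t : ℕ) :
    p.trajectory ρ ω t = (trace (funN (p.ampProd ω t) * ρ.op
        * ContinuousLinearMap.adjoint (funN (p.ampProd ω t))))⁻¹ •
      (funN (p.ampProd ω t) * ρ.op * ContinuousLinearMap.adjoint (funN (p.ampProd ω t))) := by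
  rw [trajectory, p.evolved_eq fun i _ => hω i,
    normalize_smul (Complex.ofReal_ne_zero.2 (p.probProd_pos ω t).ne')]

/-- On the sector block the two conjugations agree exactly at every time, so the limit statement for
the trajectory has no phase error. The condition on `η` is needed only for nonzero coherences with
`|0⟩`. -/
lemma freeRotation_conj (ρ : DensityOperator)
    (hcoh : (0 ∈ p.oneDimSectors ∧ ∃ m ∈ p.oneDimSectors, m ≠ 0 ∧ entry ρ.op 0 m ≠ 0) →
      ∃ k : ℕ, p.η = (k : ℝ) ^ 2) (c : ℂ) (ω : Outcomes) (t : ℕ) :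
    p.freeRotation t * (c • (p.Q * ρ.op * p.Q)) * p.freeRotation (-t)
      = funN (p.ampProd ω t) * (c • (p.Q * ρ.op * p.Q))
        * ContinuousLinearMap.adjoint (funN (p.ampProd ω t)) := by
  classical
  have hd := p.norm_ampProd_le ω t
  have hq := DensityOperator.norm_ite_le p.oneDimSectors
  have he : ∀ s : ℝ, ∀ n : ℕ, ‖Complex.exp (-Complex.I
      * ((p.ε * p.τ + Real.pi * p.ξ) * n * s : ℝ))‖ ≤ 1 := fun s n => (norm_exp_phase _).le
  refine op_ext fun n m => ?_
  rw [adjoint_funN hd, entry_mul_funN (norm_conj_le hd), entry_funN_mul hd, freeRotation,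
    freeRotation, entry_mul_funN (he _), entry_funN_mul (he _), entry_smul, Q_eq_proj, proj_eq,
    entry_mul_funN hq, entry_funN_mul hq]
  by_cases hn : n ∈ p.oneDimSectors
  swap
  · simp [hn]
  by_cases hm : m ∈ p.oneDimSectors
  swap
  · simp [hm]
  by_cases hnm : entry ρ.op n m = 0
  · simp [hnm]
  have key := p.ampProd_mul_conj hn hm ?_ ω t
  · rw [mul_right_comm, ← key, mul_right_comm]
  by_cases h : n = m
  · exact Or.inl h
  right
  -- For `n = 0` the required square is `η` itself, which is what the coherence hypothesis provides.
  have hzero : ∀ j ∈ p.oneDimSectors, j ≠ 0 → 0 ∈ p.oneDimSectors → entry ρ.op 0 j ≠ 0 →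
      ∃ k : ℕ, p.ξ * (0 : ℕ) + p.η = (k : ℝ) ^ 2 := fun j hj hj0 h0 hρ => by
    simpa using hcoh ⟨h0, j, hj, hj0, hρ⟩
  by_cases hn0 : n = 0
  · subst hn0
    exact ⟨hzero m hm (Ne.symm h) hn hnm, p.exists_sq_of_mem hm (Ne.symm h)⟩
  · refine ⟨p.exists_sq_of_mem hn hn0, ?_⟩
    by_cases hm0 : m = 0
    · subst hm0
      refine hzero n hn hn0 hm ?_
      rw [← ρ.entry_conj]
      exact (map_ne_zero _).2 hnm
    · exact p.exists_sq_of_mem hm hm0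

lemma tendsto_trajectory (ρ : DensityOperator)
    (hcoh : (0 ∈ p.oneDimSectors ∧ ∃ m ∈ p.oneDimSectors, m ≠ 0 ∧ entry ρ.op 0 m ≠ 0) →
      ∃ k : ℕ, p.η = (k : ℝ) ^ 2) (hρ : trace (ρ.op * p.Q) ≠ 0) {ω : Outcomes}
    (hω : ω ∈ goodOutcomes) :
    Tendsto (fun t : ℕ => traceNorm (p.trajectory ρ ω t - p.freeRotation t *
      ((trace (ρ.op * p.Q))⁻¹ • (p.Q * ρ.op * p.Q)) * p.freeRotation (-t))) atTop (𝓝 0) := by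
  refine (ρ.tendsto_traceNorm_conj (N := p.oneDimSectors) (d := p.ampProd ω)
    (p.norm_ampProd_le ω) (fun n hn t => p.norm_ampProd_of_mem hn ω t)
    (fun n hn => p.tendsto_ampProd hω hn) hρ).congr fun t => ?_
  rw [p.trajectory_eq ρ hω.1, p.freeRotation_conj ρ hcoh _ ω t]
  rfl

end Params

end Maser

end

/-! ### Proof of the proposition -/

theorem mainTheorem6 (p : Maser.Params) (hβ : 0 < p.β) (hdeg : p.IsDegenerate)
    (ρ : Maser.DensityOperator) :
    MeasurableSet p.eventO ∧
    ((p.outcomeMeasure ρ).real p.eventO : ℂ) = Maser.trace (ρ.op * p.Q) ∧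
    (((0 ∈ p.oneDimSectors ∧ ∃ m ∈ p.oneDimSectors, m ≠ 0 ∧ Maser.entry ρ.op 0 m ≠ 0) →
        ∃ k : ℕ, p.η = (k : ℝ) ^ 2) →
      ∀ᵐ ω ∂(p.outcomeMeasure ρ), ω ∈ p.eventO →
        Filter.Tendsto (fun t : ℕ => Maser.traceNorm
          (p.trajectory ρ ω t - p.freeRotation t *
            ((Maser.trace (ρ.op * p.Q))⁻¹ • (p.Q * ρ.op * p.Q)) * p.freeRotation (-t)))
          Filter.atTop (nhds 0)) := by
  have hN := p.oneDimSectors_nonempty hdeg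
  have hsub : Maser.Params.goodOutcomes ⊆ p.eventO :=
    Maser.Params.goodOutcomes_subset_eventO hβ hN
  have hsup : p.eventO ⊆ {ω | Maser.Params.Jumpless ω} := fun ω hω =>
    Maser.Params.jumpless_of_mem_eventO hβ hN hω
  have hnull := p.outcomeMeasure_jumpless_diff ρ
  have hmeas : MeasurableSet p.eventO := by
    -- `O` is the measurable set of good sequences together with a set of eventually constant ones,
    -- which is countable.
    rw [← Set.union_sdiff_cancel hsub]
    exact Maser.Params.measurableSet_goodOutcomes.union
      (Maser.Params.countable_jumpless_diff.mono (Set.sdiff_subset_sdiff_left hsup)).measurableSet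
  have hprob : ((p.outcomeMeasure ρ).real p.eventO : ℂ) = Maser.trace (ρ.op * p.Q) := by
    rw [← p.outcomeMeasure_jumpless ρ]
    congr 1
    refine measureReal_congr (Filter.EventuallyLE.antisymm hsup.eventuallyLE ?_)
    rw [ae_le_set]
    exact measure_mono_null (Set.sdiff_subset_sdiff_right hsub) hnull
  refine ⟨hmeas, hprob, fun hcoh => ?_⟩
  -- If `Tr(ρQ) = 0`, then `O` itself is a null set and there is nothing to prove.
  by_cases hρ : Maser.trace (ρ.op * p.Q) = 0
  · rw [hρ, Complex.ofReal_eq_zero, measureReal_eq_zero_iff] at hprob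
    filter_upwards [measure_eq_zero_iff_ae_notMem.1 hprob] with ω hω hω'
    exact absurd hω' hω
  -- A sequence in `O` has no jumps, so outside the null set of exceptional jumpless sequences it is
  -- good.
  · filter_upwards [measure_eq_zero_iff_ae_notMem.1 hnull] with ω hω hω'
    exact p.tendsto_trajectory ρ hcoh hρ (by_contra fun h => hω ⟨hsup hω', h⟩)
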